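/- **Setting.** Let $R$ be a universally complete (that is, Dedekind complete and laterally complete, hence Archimedean) real vector lattice, endowed with an associative $f$-algebra multiplication with identity $e$, and let $E=R\oplus iR$ be its complexification, with modulus $|f+ig|=\sup\{(\cos\theta) f+(\sin\theta) g:\theta\in[0,2\pi]\}$ and positive cone $E_+=\{f\in E:|f|=f\}=R_+$. For $a\in E_+$ and $n\ge 1$, $a^{1/n}$ is the unique $r\in E_+$ with $r^n=a$. A set in $R$ is order bounded if it lies in an order interval; for an order bounded sequence, $\limsup_n x_n=\inf_n\sup_{m\ge n}x_m$. For $a\in R$, $B_a$ is the principal band (order closed solid subspace) generated by $a$, $\mathbb P_a$ is the band projection onto $B_a$, and $a^\ast$ is the multiplicative inverse of $a$ in $B_a$, i.e. the element $a^\ast\in B_a$ with $aa^\ast=\mathbb P_a(e)$ (so $0^\ast=0$). An element $u\in R_+$ is a weak order unit if $B_u=R$. Let $a_n\in E$ $(n\ge 0)$ and $c\in E$, and let $S(z)=\sum_{n=0}^\infty a_n(z-c)^n$. Let $\Omega_S$ be the set of $r\in E_+$ for which $S(z)$ converges uniformly in order on $\{z\in E:|z-c|\le r\}$, i.e. for which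 there are $S(z)\in E$ and a decreasing sequence $(p_m)$ in $R$ with $\inf_m p_m=0$ such that $\bigl|\sum_{n=0}^m a_n(z-c)^n-S(z)\bigr|\le p_m$ for all $m\ge0$ and all $z\in E$ with $|z-c|\le r$. If $\Omega_S$ is order bounded, put $\rho_S=\sup\Omega_S$. If $(|a_n|^{1/n})_{n\ge1}$ is order bounded, put $L=\limsup_{n\to\infty}|a_n|^{1/n}$. **Theorem (Cauchy–Hadamard).** (i) If $(|a_n|^{1/n})_{n\ge1}$ is order bounded, then $\mathbb P_L(\Omega_S)$ is order bounded and $L^\ast=\sup_{r\in\Omega_S}\mathbb P_L(r)$. (ii) If $\Omega_S$ is order bounded, then $\bigl(\mathbb P_{\rho_S}(|a_n|^{1/n})\bigr)_{n\ge1}$ is order bounded and $\limsup_{n\to\infty}\mathbb P_{\rho_S}(|a_n|^{1/n})=\rho_S^\ast$. (iii) The sequence $(|a_n|^{1/n})_{n\ge1}$ is order bounded and $L$ is a weak order unit if and only if $\Omega_S$ is order bounded and $\rho_S$ is a weak order unit. In either case $L$ is invertible and $L^{-1}=\rho_S$. (iv) The sequence $(|a_n|^{1/n})_{n\ge1}$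 is order bounded with $L=0$ if and only if $\Omega_S=E_+$. -/

import Mathlib

/-- The `f`-algebra axioms for a lattice-ordered real algebra. Together with the ring unit
they make `R` a `Φ`-algebra. Commutativity is not assumed. -/
class IsFAlgebra (R : Type*) [Ring R] [Lattice R] : Prop where
  mul_nonneg : ∀ a b : R, 0 ≤ a → 0 ≤ b → 0 ≤ a * b
  mul_left_inf : ∀ a b c : R, a ⊓ b = 0 → 0 ≤ c → (c * a) ⊓ b = 0
  mul_right_inf : ∀ a b c : R, a ⊓ b = 0 → 0 ≤ c → (a * c) ⊓ b = 0

/-- Lateral completeness: every nonempty set of pairwise disjoint positive elements has a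
supremum. A Dedekind complete vector lattice with this property is universally complete. -/
class IsLaterallyComplete (R : Type*) [AddGroup R] [Lattice R] : Prop where
  exists_isLUB : ∀ D : Set R, D.Nonempty → (∀ x ∈ D, 0 ≤ x) →
    (∀ x ∈ D, ∀ y ∈ D, x ≠ y → x ⊓ y = 0) → ∃ s, IsLUB D s

/-- The complexification `R ⊕ iR`. -/
@[ext]
structure Cplx (R : Type*) where
  re : R
  im : R

namespace Cplx

variable {R : Type*}

section ring
variable [Ring R]

instance : Zero (Cplx R) := ⟨⟨0, 0⟩⟩
instance : One (Cplx R) := ⟨⟨1, 0⟩⟩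
instance : Add (Cplx R) := ⟨fun x y => ⟨x.re + y.re, x.im + y.im⟩⟩
instance : Neg (Cplx R) := ⟨fun x => ⟨-x.re, -x.im⟩⟩
instance : Sub (Cplx R) := ⟨fun x y => ⟨x.re - y.re, x.im - y.im⟩⟩
instance : Mul (Cplx R) :=
  ⟨fun x y => ⟨x.re * y.re - x.im * y.im, x.re * y.im + x.im * y.re⟩⟩

@[simp] theorem zero_re : (0 : Cplx R).re = 0 := rfl
@[simp] theorem zero_im : (0 : Cplx R).im = 0 := rfl
@[simp] theorem one_re : (1 : Cplx R).re = 1 := rfl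
@[simp] theorem one_im : (1 : Cplx R).im = 0 := rfl
@[simp] theorem add_re (x y : Cplx R) : (x + y).re = x.re + y.re := rfl
@[simp] theorem add_im (x y : Cplx R) : (x + y).im = x.im + y.im := rfl
@[simp] theorem neg_re (x : Cplx R) : (-x).re = -x.re := rfl
@[simp] theorem neg_im (x : Cplx R) : (-x).im = -x.im := rfl
@[simp] theorem sub_re (x y : Cplx R) : (x - y).re = x.re - y.re := rfl
@[simp] theorem sub_im (x y : Cplx R) : (x - y).im = x.im - y.im := rfl
@[simp] theorem mul_re (x y : Cplx R) : (x * y).re = x.re * y.re - x.im * y.im := rfl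
@[simp] theorem mul_im (x y : Cplx R) : (x * y).im = x.re * y.im + x.im * y.re := rfl

instance : Ring (Cplx R) where
  add_assoc x y z := by ext <;> simp [add_assoc]
  zero_add x := by ext <;> simp
  add_zero x := by ext <;> simp
  add_comm x y := by ext <;> simp [add_comm]
  neg_add_cancel x := by ext <;> simp
  sub_eq_add_neg x y := by ext <;> simp [sub_eq_add_neg]
  left_distrib x y z := by ext <;> simp <;> noncomm_ring
  right_distrib x y z := by ext <;> simp <;> noncomm_ring
  zero_mul x := by ext <;> simp
  mul_zero x := by ext <;> simp
  mul_assoc x y z := by ext <;> simp <;> noncomm_ring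
  one_mul x := by ext <;> simp
  mul_one x := by ext <;> simp
  nsmul := nsmulRec
  zsmul := zsmulRec

/-- The complex vector space structure `(s + it)(f + ig) = (sf - tg) + i(sg + tf)`. -/
instance [Module ℝ R] : Module ℂ (Cplx R) where
  smul w x := ⟨w.re • x.re - w.im • x.im, w.re • x.im + w.im • x.re⟩
  one_smul x := Cplx.ext (show (1 : ℂ).re • x.re - (1 : ℂ).im • x.im = x.re by simp)
    (show (1 : ℂ).re • x.im + (1 : ℂ).im • x.re = x.im by simp)
  mul_smul v w x := Cplx.ext
    (show (v * w).re • x.re - (v * w).im • x.im =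
      v.re • (w.re • x.re - w.im • x.im) - v.im • (w.re • x.im + w.im • x.re) by
        simp only [Complex.mul_re, Complex.mul_im]; module)
    (show (v * w).re • x.im + (v * w).im • x.re =
      v.re • (w.re • x.im + w.im • x.re) + v.im • (w.re • x.re - w.im • x.im) by
        simp only [Complex.mul_re, Complex.mul_im]; module)
  smul_zero w := Cplx.ext (show w.re • (0 : R) - w.im • (0 : R) = 0 by simp)
    (show w.re • (0 : R) + w.im • (0 : R) = 0 by simp)
  smul_add w x y := Cplx.ext
    (show w.re • (x.re + y.re) - w.im • (x.im + y.im) =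
      (w.re • x.re - w.im • x.im) + (w.re • y.re - w.im • y.im) by module)
    (show w.re • (x.im + y.im) + w.im • (x.re + y.re) =
      (w.re • x.im + w.im • x.re) + (w.re • y.im + w.im • y.re) by module)
  add_smul v w x := Cplx.ext
    (show (v + w).re • x.re - (v + w).im • x.im =
      (v.re • x.re - v.im • x.im) + (w.re • x.re - w.im • x.im) by
        simp only [Complex.add_re, Complex.add_im]; module)
    (show (v + w).re • x.im + (v + w).im • x.re =
      (v.re • x.im + v.im • x.re) + (w.re • x.im + w.im • x.re) by
        simp only [Complex.add_re, Complex.add_im]; module)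
  zero_smul x := Cplx.ext (show (0 : ℂ).re • x.re - (0 : ℂ).im • x.im = 0 by simp)
    (show (0 : ℂ).re • x.im + (0 : ℂ).im • x.re = 0 by simp)

end ring

/-- The modulus `|f + ig| = sup {(cos θ) f + (sin θ) g : θ ∈ [0, 2π]}`, an element of the real
part. The supremum always exists, by `Cplx.isLUB_modulus`. -/
noncomputable def modulus [Ring R] [Module ℝ R] [ConditionallyCompleteLattice R]
    (x : Cplx R) : R :=
  sSup ((fun θ : ℝ => Real.cos θ • x.re + Real.sin θ • x.im) '' Set.Icc 0 (2 * Real.pi))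

theorem isLUB_modulus [Ring R] [Module ℝ R] [ConditionallyCompleteLattice R]
    [IsOrderedAddMonoid R] [IsOrderedModule ℝ R] (x : Cplx R) :
    IsLUB ((fun θ : ℝ => Real.cos θ • x.re + Real.sin θ • x.im) '' Set.Icc 0 (2 * Real.pi))
      x.modulus := by
  have key : ∀ (t : ℝ) (f : R), -1 ≤ t → t ≤ 1 → t • f ≤ |f| := by
    intro t f h1 h2
    have e1 : t • f = ((1 + t) / 2) • f + ((1 - t) / 2) • (-f) := by module
    have e2 : |f| = ((1 + t) / 2) • |f| + ((1 - t) / 2) • |f| := by module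
    rw [e1, e2]
    exact add_le_add (smul_le_smul_of_nonneg_left (le_abs_self f) (by linarith))
      (smul_le_smul_of_nonneg_left (neg_le_abs f) (by linarith))
  refine isLUB_csSup ⟨_, 0, ⟨le_refl _, by positivity⟩, rfl⟩ ⟨|x.re| + |x.im|, ?_⟩
  rintro _ ⟨θ, -, rfl⟩
  exact add_le_add (key _ _ (Real.neg_one_le_cos θ) (Real.cos_le_one θ))
    (key _ _ (Real.neg_one_le_sin θ) (Real.sin_le_one θ))

end Cplx

/-- A subset of `R` is order bounded if it lies in an order interval. -/
def OrderBounded {R : Type*} [Preorder R] (s : Set R) : Prop :=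
  ∃ u v : R, s ⊆ Set.Icc u v

/-- A band: an order closed solid linear subspace. -/
structure IsBand {R : Type*} [Ring R] [Module ℝ R] [Lattice R] (B : Submodule ℝ R) : Prop where
  solid : ∀ x y : R, |x| ≤ |y| → y ∈ B → x ∈ B
  sup_mem : ∀ (D : Set R) (s : R), D.Nonempty → D ⊆ B → IsLUB D s → s ∈ B

/-- The principal band `B_a` generated by `a`: the smallest band containing `a`. -/
def principalBand {R : Type*} [Ring R] [Module ℝ R] [Lattice R] (a : R) : Submodule ℝ R :=
  sInf {B : Submodule ℝ R | IsBand B ∧ a ∈ B}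

/-- A weak order unit: a positive element that generates `R` as a band. -/
def IsWeakOrderUnit {R : Type*} [Ring R] [Module ℝ R] [Lattice R] (u : R) : Prop :=
  0 ≤ u ∧ principalBand u = ⊤

section bandProjection

theorem isBand_principalBand {R : Type*} [Ring R] [Module ℝ R] [Lattice R] (a : R) :
    IsBand (principalBand a) where
  solid x y h hy := by
    rw [principalBand, Submodule.mem_sInf] at hy ⊢
    exact fun B hB => hB.1.solid x y h (hy B hB)
  sup_mem D s hne hD hs := by
    rw [principalBand, Submodule.mem_sInf]
    intro B hB
    refine hB.1.sup_mem D s hne (fun x hx => ?_) hs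
    have := hD hx
    rw [SetLike.mem_coe, principalBand, Submodule.mem_sInf] at this
    exact this B hB

theorem self_mem_principalBand {R : Type*} [Ring R] [Module ℝ R] [Lattice R] (a : R) :
    a ∈ principalBand a := by
  rw [principalBand, Submodule.mem_sInf]
  exact fun B hB => hB.2

section lattice
variable {R : Type*} [Ring R] [Lattice R] [IsOrderedAddMonoid R]

theorem add_inf_le_of_nonneg {p q u : R} (hp : 0 ≤ p) (hq : 0 ≤ q) (hu : 0 ≤ u) :
    (p + q) ⊓ u ≤ p ⊓ u + q ⊓ u := by
  rw [add_inf, inf_add, inf_add]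
  refine le_inf (le_inf inf_le_left ?_) (le_inf ?_ ?_)
  · exact inf_le_right.trans (le_add_of_nonneg_right hq)
  · exact inf_le_right.trans (le_add_of_nonneg_left hp)
  · exact inf_le_right.trans (le_add_of_nonneg_left hu)

theorem abs_inf_eq_zero_mono {x y u : R} (h : |x| ≤ |y|) (hy : |y| ⊓ |u| = 0) :
    |x| ⊓ |u| = 0 :=
  le_antisymm ((inf_le_inf_right _ h).trans hy.le) (le_inf (abs_nonneg _) (abs_nonneg _))

theorem abs_add_inf_eq_zero {x y u : R} (hx : |x| ⊓ |u| = 0) (hy : |y| ⊓ |u| = 0) :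
    |x + y| ⊓ |u| = 0 := by
  refine le_antisymm ?_ (le_inf (abs_nonneg _) (abs_nonneg _))
  calc |x + y| ⊓ |u| ≤ (|x| + |y|) ⊓ |u| := inf_le_inf_right _ (abs_add_le x y)
    _ ≤ |x| ⊓ |u| + |y| ⊓ |u| :=
      add_inf_le_of_nonneg (abs_nonneg _) (abs_nonneg _) (abs_nonneg _)
    _ = 0 := by rw [hx, hy, add_zero]

theorem add_eq_sup_of_inf_eq_zero {p q : R} (h : p ⊓ q = 0) : p + q = p ⊔ q := by
  rw [← inf_add_sup p q, h, zero_add]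

variable [Module ℝ R] [IsOrderedModule ℝ R]

theorem abs_smul_le_nsmul (t : ℝ) (x : R) : ∃ n : ℕ, |t • x| ≤ n • |x| := by
  obtain ⟨n, hn⟩ := exists_nat_ge |t|
  refine ⟨n, ?_⟩
  obtain ⟨h1, h2⟩ := abs_le.1 hn
  have key : ∀ s : ℝ, -(n : ℝ) ≤ s → s ≤ n → s • x ≤ n • |x| := by
    intro s h1 h2
    have e1 : s • x = ((n + s) / 2) • x + ((n - s) / 2) • (-x) := by module
    have e2 : n • |x| = (((n : ℝ) + s) / 2) • |x| + (((n : ℝ) - s) / 2) • |x| := by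
      rw [← Nat.cast_smul_eq_nsmul ℝ]; module
    rw [e1, e2]
    exact add_le_add (smul_le_smul_of_nonneg_left (le_abs_self x) (by linarith))
      (smul_le_smul_of_nonneg_left (neg_le_abs x) (by linarith))
  refine abs_le'.2 ⟨key t h1 h2, ?_⟩
  rw [← neg_smul]
  exact key (-t) (by linarith) (by linarith)

/-- The disjoint complement `{u}ᵈ`. -/
def disjointCompl (u : R) : Submodule ℝ R where
  carrier := {x | |x| ⊓ |u| = 0}
  zero_mem' := by simp
  add_mem' hx hy := abs_add_inf_eq_zero hx hy
  smul_mem' t x hx := by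
    have hn : ∀ n : ℕ, abs (n • |x|) ⊓ |u| = 0 := by
      intro n
      induction n with
      | zero => simp
      | succ k ih =>
        rw [succ_nsmul]
        exact abs_add_inf_eq_zero ih (by rw [abs_abs]; exact hx)
    obtain ⟨n, h⟩ := abs_smul_le_nsmul t x
    exact abs_inf_eq_zero_mono (h.trans (le_abs_self _)) (hn n)

theorem isBand_disjointCompl (u : R) : IsBand (disjointCompl u) where
  solid x y h hy := abs_inf_eq_zero_mono h hy
  sup_mem D s hne hD hs := by
    obtain ⟨w₀, hw₀⟩ := hne
    have hd : ∀ w ∈ D, |w| ⊓ |u| = 0 := fun w hw => hD hw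
    have hneg : s⁻ ⊓ |u| = 0 := by
      refine le_antisymm ?_ (le_inf (negPart_nonneg s) (abs_nonneg _))
      refine le_trans (inf_le_inf_right _ ?_) (hd w₀ hw₀).le
      exact (negPart_anti (hs.1 hw₀)).trans
        (by rw [← posPart_add_negPart w₀]; exact le_add_of_nonneg_left (posPart_nonneg _))
    set t := s⁺ ⊓ |u| with ht
    have ht0 : 0 ≤ t := le_inf (posPart_nonneg s) (abs_nonneg _)
    have hts : t + s⁻ = t ⊔ s⁻ := by
      apply add_eq_sup_of_inf_eq_zero
      refine le_antisymm ?_ (le_inf ht0 (negPart_nonneg s))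
      rw [← hneg, inf_comm s⁻]
      exact inf_le_inf_right _ inf_le_right
    have hle : s ≤ s - t := by
      refine hs.2 fun w hw => ?_
      have h1 : w⁺ + t ≤ s⁺ := by
        rw [add_eq_sup_of_inf_eq_zero]
        · exact sup_le (posPart_mono (hs.1 hw)) inf_le_left
        · refine le_antisymm ?_ (le_inf (posPart_nonneg w) ht0)
          refine le_trans (inf_le_inf ?_ inf_le_right) (hd w hw).le
          rw [← posPart_add_negPart w]; exact le_add_of_nonneg_right (negPart_nonneg _)
      have h2 : t ≤ s⁺ - w := by
        rw [le_sub_iff_add_le, add_comm]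
        exact (add_le_add_left (le_posPart w) t).trans h1
      have h3 : s⁻ ≤ s⁺ - w := by
        have := hs.1 hw
        rw [← posPart_sub_negPart s] at this
        rw [le_sub_comm]; exact this
      have h4 : t + s⁻ ≤ s⁺ - w := hts ▸ sup_le h2 h3
      have h5 : w ≤ s⁺ - (t + s⁻) := by rw [le_sub_comm]; exact h4
      calc w ≤ s⁺ - (t + s⁻) := h5
        _ = (s⁺ - s⁻) - t := by abel
        _ = s - t := by rw [posPart_sub_negPart]
    have ht' : t = 0 := le_antisymm (by simpa using hle) ht0
    change |s| ⊓ |u| = 0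
    refine le_antisymm ?_ (le_inf (abs_nonneg _) (abs_nonneg _))
    rw [← posPart_add_negPart s]
    refine (add_inf_le_of_nonneg (posPart_nonneg _) (negPart_nonneg _) (abs_nonneg _)).trans ?_
    rw [← ht, ht', hneg, add_zero]

end lattice

variable {R : Type*} [Ring R] [Module ℝ R]
variable [ConditionallyCompleteLattice R] [IsOrderedAddMonoid R] [IsOrderedModule ℝ R]

theorem exists_component_of_nonneg (a x : R) (hx : 0 ≤ x) :
    ∃ y ∈ principalBand a, ∀ w ∈ principalBand a, |x - y| ⊓ |w| = 0 := by
  set y := ⨆ n : ℕ, x ⊓ n • |a| with hy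
  have hbdd : BddAbove (Set.range fun n : ℕ => x ⊓ n • |a|) :=
    ⟨x, by rintro _ ⟨n, rfl⟩; exact inf_le_left⟩
  have hlub : IsLUB (Set.range fun n : ℕ => x ⊓ n • |a|) y := isLUB_ciSup hbdd
  have hyx : y ≤ x := hlub.2 (by rintro _ ⟨n, rfl⟩; exact inf_le_left)
  have hB := isBand_principalBand a
  refine ⟨y, hB.sup_mem _ _ (Set.range_nonempty _) ?_ hlub, ?_⟩
  · rintro _ ⟨n, rfl⟩
    have hna : n • |a| ∈ principalBand a :=
      nsmul_mem (hB.solid _ a (abs_abs a).le (self_mem_principalBand a)) n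
    have h0 : 0 ≤ n • |a| := nsmul_nonneg (abs_nonneg a) n
    refine hB.solid _ _ ?_ hna
    rw [abs_of_nonneg h0, abs_of_nonneg (le_inf hx h0)]
    exact inf_le_right
  · have ha : |a| ⊓ |x - y| = 0 := by
      rw [abs_of_nonneg (sub_nonneg.2 hyx)]
      refine le_antisymm ?_ (le_inf (abs_nonneg _) (sub_nonneg.2 hyx))
      set t := |a| ⊓ (x - y)
      have : y ≤ y - t := by
        refine hlub.2 ?_
        rintro _ ⟨n, rfl⟩
        rw [le_sub_iff_add_le]
        refine le_trans (le_inf ?_ ?_) (hlub.1 ⟨n + 1, rfl⟩)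
        · calc x ⊓ n • |a| + t ≤ y + (x - y) := add_le_add (hlub.1 ⟨n, rfl⟩) inf_le_right
            _ = x := by abel
        · rw [succ_nsmul]
          exact add_le_add inf_le_right inf_le_left
      simpa using this
    intro w hw
    rw [principalBand, Submodule.mem_sInf] at hw
    have : w ∈ disjointCompl (x - y) := hw _ ⟨isBand_disjointCompl _, ha⟩
    rw [inf_comm]
    exact this

theorem exists_component (a x : R) :
    ∃ y ∈ principalBand a, ∀ w ∈ principalBand a, |x - y| ⊓ |w| = 0 := by
  obtain ⟨y, hy, hyd⟩ := exists_component_of_nonneg a x⁺ (posPart_nonneg x)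
  obtain ⟨z, hz, hzd⟩ := exists_component_of_nonneg a x⁻ (negPart_nonneg x)
  refine ⟨y - z, sub_mem hy hz, fun w hw => ?_⟩
  have e : x - (y - z) = (x⁺ - y) + -(x⁻ - z) := by
    nth_rewrite 1 [← posPart_sub_negPart x]
    abel
  rw [e]
  exact abs_add_inf_eq_zero (hyd w hw) (by rw [abs_neg]; exact hzd w hw)

/-- The band projection `P_a` of `R` onto the principal band `B_a`: `bandProj a x` is the
component of `x` in `B_a` with respect to the decomposition `R = B_a ⊕ B_aᵈ`. -/
noncomputable def bandProj (a x : R) : R := (exists_component a x).choose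

theorem bandProj_mem (a x : R) : bandProj a x ∈ principalBand a :=
  (exists_component a x).choose_spec.1

theorem sub_bandProj_disjoint (a x : R) :
    ∀ w ∈ principalBand a, |x - bandProj a x| ⊓ |w| = 0 :=
  (exists_component a x).choose_spec.2

theorem bandProj_unique {a x y : R} (hy : y ∈ principalBand a)
    (hd : ∀ w ∈ principalBand a, |x - y| ⊓ |w| = 0) : bandProj a x = y := by
  have hm : bandProj a x - y ∈ principalBand a := sub_mem (bandProj_mem a x) hy
  have h1 := hd _ hm
  have h2 := sub_bandProj_disjoint a x _ hm
  have h3 : |bandProj a x - y| ⊓ |bandProj a x - y| = 0 := by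
    have e : bandProj a x - y = (x - y) + -(x - bandProj a x) := by abel
    nth_rewrite 1 [e]
    exact abs_add_inf_eq_zero h1 (by rw [abs_neg]; exact h2)
  rw [inf_idem] at h3
  have h4 : bandProj a x - y = 0 := le_antisymm ((le_abs_self _).trans h3.le)
    (neg_nonpos.1 ((neg_le_abs _).trans h3.le))
  exact sub_eq_zero.1 h4

/-- `y` is the multiplicative inverse `a*` of `a` in the band `B_a`, whose multiplicative
identity is `P_a(e)`. For `a = 0` the band is `{0}` and this says `y = 0`. -/
def IsBandInverse (a y : R) : Prop :=
  y ∈ principalBand a ∧ a * y = bandProj a 1 ∧ y * a = bandProj a 1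

theorem mul_eq_zero_of_disjoint [IsFAlgebra R] {x y : R} (h : |x| ⊓ |y| = 0) : x * y = 0 := by
  have key : ∀ p q : R, 0 ≤ p → 0 ≤ q → p ≤ |x| → q ≤ |y| → p * q = 0 := by
    intro p q hp hq hpx hqy
    have h0 : p ⊓ q = 0 := le_antisymm ((inf_le_inf hpx hqy).trans h.le) (le_inf hp hq)
    have h1 : (p * q) ⊓ q = 0 := IsFAlgebra.mul_right_inf p q q h0 hq
    have h2 : (p * q) ⊓ (p * q) = 0 :=
      IsFAlgebra.mul_left_inf q (p * q) p (by rw [inf_comm]; exact h1) hp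
    rwa [inf_idem] at h2
  have hP : ∀ z : R, z⁺ ≤ |z| := fun z => by
    rw [← posPart_add_negPart z]; exact le_add_of_nonneg_right (negPart_nonneg z)
  have hN : ∀ z : R, z⁻ ≤ |z| := fun z => by
    rw [← posPart_add_negPart z]; exact le_add_of_nonneg_left (posPart_nonneg z)
  rw [← posPart_sub_negPart x, ← posPart_sub_negPart y, sub_mul, mul_sub, mul_sub,
    key _ _ (posPart_nonneg x) (posPart_nonneg y) (hP x) (hP y),
    key _ _ (posPart_nonneg x) (negPart_nonneg y) (hP x) (hN y),
    key _ _ (negPart_nonneg x) (posPart_nonneg y) (hN x) (hP y),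
    key _ _ (negPart_nonneg x) (negPart_nonneg y) (hN x) (hN y)]
  simp

/-- The inverse of `a` in `B_a` is unique. -/
theorem IsBandInverse.unique [IsFAlgebra R] {a y z : R} (hy : IsBandInverse a y)
    (hz : IsBandInverse a z) : y = z := by
  have h1 : bandProj a 1 * y = y := by
    have := mul_eq_zero_of_disjoint (sub_bandProj_disjoint a 1 y hy.1)
    rw [sub_mul, one_mul, sub_eq_zero] at this
    exact this.symm
  have h2 : z * bandProj a 1 = z := by
    have := mul_eq_zero_of_disjoint
      ((inf_comm _ _).trans (sub_bandProj_disjoint a 1 z hz.1))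
    rw [mul_sub, mul_one, sub_eq_zero] at this
    exact this.symm
  rw [← h1, ← hz.2.2, mul_assoc, hy.2.1, h2]

end bandProjection

open Classical in
/-- The `n`-th root `a^(1/n)` of a positive element `a`: the `r ≥ 0` with `r ^ n = a`. -/
noncomputable def nthRoot {R : Type*} [Ring R] [Lattice R] (n : ℕ) (a : R) : R :=
  if h : ∃ r : R, 0 ≤ r ∧ r ^ n = a then h.choose else 0

/-- The order limit superior `inf_n sup_{m ≥ n} x_m`. -/
noncomputable def orderLimsup {R : Type*} [ConditionallyCompleteLattice R] (x : ℕ → R) : R :=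
  ⨅ n : ℕ, ⨆ m : Set.Ici n, x m

section powerSeries

variable {R : Type*} [Ring R] [Module ℝ R] [ConditionallyCompleteLattice R]

/-- The sequence `(|a_n|^(1/n))_{n ≥ 1}`, enumerated as `k ↦ |a_(k+1)|^(1/(k+1))`, `k ≥ 0`. -/
noncomputable def rootSeq (a : ℕ → Cplx R) (k : ℕ) : R := nthRoot (k + 1) (a (k + 1)).modulus

/-- The power series `∑ a_n (z - c)^n` converges uniformly in order on `D`: there are a sum
function `S` and a sequence `p_m ↓ 0` such that `|∑_{n ≤ m} a_n (z - c)^n - S(z)| ≤ p_m` for all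
`m` and all `z ∈ D`. -/
def ConvergesUniformlyInOrder (a : ℕ → Cplx R) (c : Cplx R) (D : Set (Cplx R)) : Prop :=
  ∃ (S : Cplx R → Cplx R) (p : ℕ → R), Antitone p ∧ IsGLB (Set.range p) 0 ∧
    ∀ m : ℕ, ∀ z ∈ D, ((∑ n ∈ Finset.range (m + 1), a n * (z - c) ^ n) - S z).modulus ≤ p m

/-- The order closed ball `{z : |z - c| ≤ r}`. -/
def orderBall (c : Cplx R) (r : R) : Set (Cplx R) := {z | (z - c).modulus ≤ r}

/-- `Ω_S`: the positive `r` for which the series converges uniformly in order on the order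
closed ball of radius `r`. The positive cone of `R ⊕ iR` is that of `R`. -/
def convergenceSet (a : ℕ → Cplx R) (c : Cplx R) : Set R :=
  {r | 0 ≤ r ∧ ConvergesUniformlyInOrder a c (orderBall c r)}

/-- The radius of convergence `ρ_S = sup Ω_S`, for order bounded `Ω_S`. -/
noncomputable def radius (a : ℕ → Cplx R) (c : Cplx R) : R := sSup (convergenceSet a c)

end powerSeries

/-! `R` behaves like an algebra of functions, and the proof imitates the pointwise argument with
idempotents in the role of indicator functions. Band projections are multiplications by idempotents
(`bandProj_eq_mul`). If `x ≤ y` fails, it fails by some real `ε > 0` on a nonzero idempotent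
(`exists_idem_gap`). So inequalities may be checked locally, on some nonzero idempotent below each
given one (`le_of_locally`), where every element is bounded by a real number and as close to one as
desired (`locally_le_smul`, `locally_approx`). Lateral completeness glues local upper bounds into a
global one (`bddAbove_of_locally`).

Two estimates carry the theorem. If `r ∈ Ω_S`, the terms `|a_n| r^n` have a common bound, because at
`z = c + r` each term is a difference of two errors. Locally this bound is a real `N`, and `N^(1/n)
→ 1` gives `r L ≤ 1` (`mul_orderLimsup_le_one`). Conversely, if `r L ≤ t < 1`, then locally `r
|a_n|^(1/n) ≤ s < 1` from some index on. A geometric series then bounds the partial sums of `∑ |a_n|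
r^n` locally, hence globally, and the tails of this series serve as `p_m`
(`mem_convergenceSet_of_mul_orderLimsup_le`).

For (i), the first estimate bounds the projection of `Ω_S` by `L*`, and the second puts `t L*` in
`Ω_S` for `0 ≤ t < 1`. For (ii), let `Λ` be the limit superior of the projected roots. The first
estimate gives `ρ Λ ≤ P_ρ(e)`; if equality failed by `δ` on an idempotent, the second would allow
the radius to grow there by the factor `1 + δ`. Part (iii) is the case where the projections are the
identity. For (iv), `L = 0` lets the second estimate apply to every `r`, and conversely `n L ≤ 1`
for all `n` forces `L = 0`. -/

set_option linter.unusedSectionVars false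

/-! ### Idempotents and band projections in an `f`-algebra -/

section FAlgebra

variable {R : Type*} [Ring R] [Algebra ℝ R] [ConditionallyCompleteLattice R]
  [IsOrderedAddMonoid R] [IsOrderedModule ℝ R] [IsFAlgebra R]

theorem mul_eq_zero_of_inf_eq_zero {x y : R} (h : x ⊓ y = 0) : x * y = 0 := by
  have hx : 0 ≤ x := h ▸ inf_le_left
  have hy : 0 ≤ y := h ▸ inf_le_right
  exact mul_eq_zero_of_disjoint (by rwa [abs_of_nonneg hx, abs_of_nonneg hy])

theorem mul_self_nonneg_of_fAlgebra (x : R) : 0 ≤ x * x := by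
  have h1 : x⁺ * x⁻ = 0 := mul_eq_zero_of_inf_eq_zero (posPart_inf_negPart_eq_zero x)
  have h2 : x⁻ * x⁺ = 0 :=
    mul_eq_zero_of_inf_eq_zero ((inf_comm _ _).trans (posPart_inf_negPart_eq_zero x))
  have h3 : x * x = x⁺ * x⁺ + x⁻ * x⁻ := by
    nth_rewrite 1 2 [← posPart_sub_negPart x]
    rw [sub_mul, mul_sub, mul_sub, h1, h2]
    abel
  rw [h3]
  exact add_nonneg (IsFAlgebra.mul_nonneg _ _ (posPart_nonneg x) (posPart_nonneg x))
    (IsFAlgebra.mul_nonneg _ _ (negPart_nonneg x) (negPart_nonneg x))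

instance isOrderedRing_of_fAlgebra : IsOrderedRing R :=
  haveI : ZeroLEOneClass R := ⟨by simpa using mul_self_nonneg_of_fAlgebra (1 : R)⟩
  IsOrderedRing.of_mul_nonneg IsFAlgebra.mul_nonneg

theorem abs_mul_le_mul_abs (x y : R) : |x * y| ≤ |x| * |y| := by
  have hx := posPart_nonneg x
  have hx' := negPart_nonneg x
  have hy := posPart_nonneg y
  have hy' := negPart_nonneg y
  have e1 : x * y = x⁺ * y⁺ + x⁻ * y⁻ - (x⁺ * y⁻ + x⁻ * y⁺) := by
    nth_rewrite 1 [← posPart_sub_negPart x, ← posPart_sub_negPart y]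
    noncomm_ring
  have e2 : |x| * |y| = x⁺ * y⁺ + x⁻ * y⁻ + (x⁺ * y⁻ + x⁻ * y⁺) := by
    rw [← posPart_add_negPart x, ← posPart_add_negPart y]
    noncomm_ring
  have h1 : 0 ≤ x⁺ * y⁺ + x⁻ * y⁻ := add_nonneg (mul_nonneg hx hy) (mul_nonneg hx' hy')
  have h2 : 0 ≤ x⁺ * y⁻ + x⁻ * y⁺ := add_nonneg (mul_nonneg hx hy') (mul_nonneg hx' hy)
  rw [e1, e2, abs_le']
  constructor
  · exact sub_le_self _ h2 |>.trans (le_add_of_nonneg_right h2)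
  · rw [neg_sub]
    exact (sub_le_self _ h1).trans (le_add_of_nonneg_left h1)

theorem IsIdempotentElem.nonneg_of_fAlgebra {p : R} (hp : IsIdempotentElem p) : 0 ≤ p :=
  hp.eq ▸ mul_self_nonneg_of_fAlgebra p

theorem IsIdempotentElem.le_one_of_fAlgebra {p : R} (hp : IsIdempotentElem p) : p ≤ 1 :=
  sub_nonneg.1 hp.one_sub.nonneg_of_fAlgebra

theorem IsIdempotentElem.inf_one_sub {p : R} (hp : IsIdempotentElem p) : p ⊓ (1 - p) = 0 := by
  have h0 : 0 ≤ p ⊓ (1 - p) := le_inf hp.nonneg_of_fAlgebra hp.one_sub.nonneg_of_fAlgebra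
  refine le_antisymm ?_ h0
  calc p ⊓ (1 - p) = (p ⊓ (1 - p)) * p + (p ⊓ (1 - p)) * (1 - p) := by noncomm_ring
    _ ≤ (1 - p) * p + p * (1 - p) :=
      add_le_add (mul_le_mul_of_nonneg_right inf_le_right hp.nonneg_of_fAlgebra)
        (mul_le_mul_of_nonneg_right inf_le_left hp.one_sub.nonneg_of_fAlgebra)
    _ = 0 := by rw [hp.mul_one_sub_self, hp.one_sub_mul_self, add_zero]

/-- The `f`-algebra axiom keeps `p * y` disjoint from `1 - p` for `y ≥ 0`, and disjoint elements
have product zero. Applied to `p` and to `1 - p`, this makes idempotents central before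
commutativity is known. -/
theorem IsIdempotentElem.mul_mul_one_sub {p : R} (hp : IsIdempotentElem p) (x : R) :
    p * x * (1 - p) = 0 := by
  have key : ∀ y : R, 0 ≤ y → p * y * (1 - p) = 0 := fun y hy =>
    mul_eq_zero_of_inf_eq_zero (IsFAlgebra.mul_right_inf _ _ _ hp.inf_one_sub hy)
  rw [← posPart_sub_negPart x, mul_sub p, sub_mul, key _ (posPart_nonneg x),
    key _ (negPart_nonneg x), sub_zero]

/-- Idempotents of an Archimedean `f`-algebra are central. -/
theorem IsIdempotentElem.mul_comm_of_fAlgebra {p : R} (hp : IsIdempotentElem p) (x : R) :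
    p * x = x * p := by
  have h1 := hp.mul_mul_one_sub x
  have h2 := hp.one_sub.mul_mul_one_sub x
  rw [sub_sub_cancel, sub_mul, one_mul, sub_mul, sub_eq_zero] at h2
  rw [mul_sub, mul_one, sub_eq_zero] at h1
  rw [h1, h2]

theorem IsIdempotentElem.mul_of_fAlgebra {p q : R} (hp : IsIdempotentElem p)
    (hq : IsIdempotentElem q) : IsIdempotentElem (p * q) :=
  IsIdempotentElem.mul_of_commute (hp.mul_comm_of_fAlgebra q) hp hq

/-- Left multiplication by an idempotent is monotone. -/
theorem IsIdempotentElem.mul_le_mul {p x y : R} (hp : IsIdempotentElem p) (h : x ≤ y) :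
    p * x ≤ p * y := mul_le_mul_of_nonneg_left h hp.nonneg_of_fAlgebra

theorem inf_eq_zero_of_idem_mul {p x y : R} (hp : IsIdempotentElem p) (hx : 0 ≤ x) (hy : 0 ≤ y)
    (hpx : p * x = x) (hpy : p * y = 0) : x ⊓ y = 0 := by
  have h0 : 0 ≤ x ⊓ y := le_inf hx hy
  refine le_antisymm ?_ h0
  have h1 : p * (x ⊓ y) ≤ 0 := hpy ▸ hp.mul_le_mul inf_le_right
  have h2 : (1 - p) * (x ⊓ y) ≤ 0 := by
    have := hp.one_sub.mul_le_mul (inf_le_left : x ⊓ y ≤ x)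
    rwa [sub_mul 1 p x, one_mul, hpx, sub_self] at this
  calc x ⊓ y = p * (x ⊓ y) + (1 - p) * (x ⊓ y) := by noncomm_ring
    _ ≤ 0 := add_nonpos h1 h2

/-- The unit of a principal band is idempotent. -/
theorem isIdempotentElem_bandProj_one (a : R) : IsIdempotentElem (bandProj a 1) := by
  have := mul_eq_zero_of_disjoint (sub_bandProj_disjoint a 1 _ (bandProj_mem a 1))
  rw [sub_mul, one_mul, sub_eq_zero] at this
  exact this.symm

theorem bandProj_one_mul_of_mem {a x : R} (hx : x ∈ principalBand a) : bandProj a 1 * x = x := by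
  have := mul_eq_zero_of_disjoint (sub_bandProj_disjoint a 1 x hx)
  rw [sub_mul, one_mul, sub_eq_zero] at this
  exact this.symm

theorem bandProj_eq_mul (a x : R) : bandProj a x = bandProj a 1 * x := by
  have h1 := bandProj_one_mul_of_mem (bandProj_mem a x)
  have h2 := mul_eq_zero_of_disjoint (sub_bandProj_disjoint a x _ (bandProj_mem a 1))
  rw [← (isIdempotentElem_bandProj_one a).mul_comm_of_fAlgebra, mul_sub, h1, sub_eq_zero] at h2
  exact h2.symm

theorem mem_principalBand_iff {a x : R} : x ∈ principalBand a ↔ bandProj a 1 * x = x :=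
  ⟨bandProj_one_mul_of_mem, fun h => by
    rw [← h, ← bandProj_eq_mul]; exact bandProj_mem a x⟩

theorem bandProj_one_mul_self (a : R) : bandProj a 1 * a = a :=
  bandProj_one_mul_of_mem (self_mem_principalBand a)

/-- An idempotent annihilating `a` annihilates the band generated by `a`. -/
theorem IsIdempotentElem.mul_bandProj_one_eq_zero {a q : R} (hq : IsIdempotentElem q)
    (h : q * a = 0) : q * bandProj a 1 = 0 := by
  have h1 : q * |a| = 0 := by
    have hd : |q| ⊓ |a| = 0 := by
      have hP : ∀ x : R, 0 ≤ q * x⁺ := fun x =>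
        mul_nonneg hq.nonneg_of_fAlgebra (posPart_nonneg x)
      have hN : ∀ x : R, 0 ≤ q * x⁻ := fun x =>
        mul_nonneg hq.nonneg_of_fAlgebra (negPart_nonneg x)
      have e : q * a⁺ = q * a⁻ := by
        rw [← sub_eq_zero, ← mul_sub, posPart_sub_negPart, h]
      -- The elements `q * a⁺` and `q * a⁻` are disjoint, and they are equal because `q * a = 0`;
      -- hence both vanish.
      have hi : (q * a⁺) ⊓ (q * a⁻) = 0 := by
        refine IsFAlgebra.mul_left_inf _ _ _ ?_ hq.nonneg_of_fAlgebra
        rw [inf_comm]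
        refine IsFAlgebra.mul_left_inf _ _ _ ?_ hq.nonneg_of_fAlgebra
        rw [inf_comm]
        exact posPart_inf_negPart_eq_zero a
      rw [← e, inf_idem] at hi
      refine inf_eq_zero_of_idem_mul hq (abs_nonneg _) (abs_nonneg _) ?_ ?_
      · rw [abs_of_nonneg hq.nonneg_of_fAlgebra, hq.eq]
      · rw [← posPart_add_negPart a, mul_add, ← e, hi, add_zero]
    rw [← abs_of_nonneg hq.nonneg_of_fAlgebra]
    exact mul_eq_zero_of_disjoint (by rwa [abs_abs, abs_abs])
  have h2 : |a| ⊓ |q| = 0 := by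
    rw [inf_comm]
    refine inf_eq_zero_of_idem_mul hq (abs_nonneg _) (abs_nonneg _) ?_ h1
    rw [abs_of_nonneg hq.nonneg_of_fAlgebra, hq.eq]
  have h3 := bandProj_mem a 1
  rw [principalBand, Submodule.mem_sInf] at h3
  -- The disjoint complement of `q` is a band containing `a`, so it contains the whole principal
  -- band of `a`.
  have h4 : bandProj a 1 ∈ disjointCompl q := h3 _ ⟨isBand_disjointCompl q, h2⟩
  exact mul_eq_zero_of_disjoint ((inf_comm _ _).trans h4)

/-! ### Local comparison with real scalars, and commutativity -/

theorem exists_idem_mul_eq_posPart (x : R) :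
    ∃ p : R, IsIdempotentElem p ∧ p * x = x⁺ ∧ p * x⁺ = x⁺ := by
  have h1 := bandProj_one_mul_self x⁺
  refine ⟨bandProj x⁺ 1, isIdempotentElem_bandProj_one _, ?_, h1⟩
  have h2 : bandProj x⁺ 1 * x⁻ = 0 := by
    have h3 : x⁺ ∈ disjointCompl x⁻ := by
      change |x⁺| ⊓ |x⁻| = 0
      rw [abs_of_nonneg (posPart_nonneg x), abs_of_nonneg (negPart_nonneg x)]
      exact posPart_inf_negPart_eq_zero x
    have h4 := bandProj_mem x⁺ 1
    rw [principalBand, Submodule.mem_sInf] at h4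
    exact mul_eq_zero_of_disjoint (h4 _ ⟨isBand_disjointCompl _, h3⟩)
  nth_rewrite 2 [← posPart_sub_negPart x]
  rw [mul_sub, h2, sub_zero, h1]

/-- The Archimedean property from Dedekind completeness: the supremum of the multiples of `x` stays
an upper bound after subtracting `x`. -/
theorem nonpos_of_forall_nsmul_le {x y : R} (h : ∀ n : ℕ, n • x ≤ y) : x ≤ 0 := by
  have hl : IsLUB (Set.range fun n : ℕ => n • x) (⨆ n : ℕ, n • x) :=
    isLUB_ciSup ⟨y, by rintro _ ⟨n, rfl⟩; exact h n⟩
  have : (⨆ n : ℕ, n • x) ≤ (⨆ n : ℕ, n • x) - x := by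
    refine hl.2 ?_
    rintro _ ⟨n, rfl⟩
    rw [le_sub_iff_add_le, ← succ_nsmul]
    exact hl.1 ⟨n + 1, rfl⟩
  simpa using this

theorem le_of_forall_pos_le_add_smul {x z y : R} (h : ∀ ε : ℝ, 0 < ε → x ≤ z + ε • y) :
    x ≤ z := by
  rw [← sub_nonpos]
  refine nonpos_of_forall_nsmul_le (y := |y|) fun n => ?_
  have hn : (0 : ℝ) < n + 1 := by positivity
  have h1 : x - z ≤ ((n : ℝ) + 1)⁻¹ • |y| := by
    rw [sub_le_iff_le_add']
    exact (h _ (inv_pos.2 hn)).trans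
      (add_le_add_right (smul_le_smul_of_nonneg_left (le_abs_self y) (by positivity)) z)
  rw [← Nat.cast_smul_eq_nsmul ℝ]
  calc (n : ℝ) • (x - z) ≤ (n : ℝ) • ((n : ℝ) + 1)⁻¹ • |y| :=
        smul_le_smul_of_nonneg_left h1 (by positivity)
    _ = ((n : ℝ) / (n + 1)) • |y| := by rw [smul_smul, div_eq_mul_inv]
    _ ≤ (1 : ℝ) • |y| :=
        smul_le_smul_of_nonneg_right ((div_le_one hn).2 (by linarith)) (abs_nonneg y)
    _ = |y| := one_smul _ _

/-- If `x ≤ y` fails, it fails by a definite amount on some nonzero idempotent. -/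
theorem exists_idem_gap {x y : R} (h : ¬ x ≤ y) :
    ∃ p : R, IsIdempotentElem p ∧ p ≠ 0 ∧ ∃ ε : ℝ, 0 < ε ∧ p * y + ε • p ≤ p * x := by
  by_contra! hc
  refine h (le_of_forall_pos_le_add_smul (y := (1 : R)) fun ε hε => ?_)
  obtain ⟨p, hp, h1, h2⟩ := exists_idem_mul_eq_posPart (x - (y + ε • 1))
  by_cases h0 : p = 0
  · rw [h0, zero_mul] at h1
    rw [← sub_nonpos]
    exact (le_posPart _).trans h1.symm.le
  · refine absurd ?_ (hc p hp h0 ε hε)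
    have : 0 ≤ p * (x - (y + ε • 1)) := h1 ▸ posPart_nonneg _
    rwa [mul_sub, mul_add, mul_smul_comm, mul_one, sub_nonneg] at this

/-- `P` holds locally if below every nonzero idempotent there is a nonzero idempotent at which
`P` holds. -/
def Locally (P : R → Prop) : Prop :=
  ∀ p : R, IsIdempotentElem p → p ≠ 0 → ∃ q : R, IsIdempotentElem q ∧ q ≠ 0 ∧ p * q = q ∧ P q

theorem Locally.mono {P Q : R → Prop} (h : Locally P)
    (hPQ : ∀ q, IsIdempotentElem q → q ≠ 0 → P q → Q q) : Locally Q := fun p hp h0 =>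
  let ⟨q, hq, hq0, hpq, hP⟩ := h p hp h0
  ⟨q, hq, hq0, hpq, hPQ q hq hq0 hP⟩

theorem Locally.and {P Q : R → Prop} (hP : Locally P) (hQ : Locally Q)
    (hmono : ∀ p q, IsIdempotentElem p → IsIdempotentElem q → p * q = q → P p → P q) :
    Locally fun q => P q ∧ Q q := fun p hp h0 =>
  let ⟨q, hq, hq0, hpq, h1⟩ := hP p hp h0
  let ⟨r, hr, hr0, hqr, h2⟩ := hQ q hq hq0
  ⟨r, hr, hr0, by rw [← hqr, ← mul_assoc, hpq], hmono q r hq hr hqr h1, h2⟩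

theorem not_smul_idem_nonpos {p : R} (hp : IsIdempotentElem p) (h0 : p ≠ 0) {ε : ℝ} (hε : 0 < ε) :
    ¬ ε • p ≤ 0 := fun h => h0 <| le_antisymm (by
      have := smul_le_smul_of_nonneg_left h (inv_pos.2 hε).le
      rwa [smul_zero, inv_smul_smul₀ hε.ne'] at this) hp.nonneg_of_fAlgebra

/-- A gap between `x` and `y` on `p` persists on every smaller idempotent, so it rules out the
inequality on each nonzero one of them. -/
theorem le_of_locally {x y : R} (h : Locally fun q => q * x ≤ q * y) : x ≤ y := by
  by_contra hc
  obtain ⟨p, hp, h0, ε, hε, hgap⟩ := exists_idem_gap hc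
  obtain ⟨q, hq, hq0, hpq, hle⟩ := h p hp h0
  have h1 := hq.mul_le_mul hgap
  have h2 : q * p = q := by rw [← hp.mul_comm_of_fAlgebra, hpq]
  rw [mul_add, ← mul_assoc, ← mul_assoc, mul_smul_comm, h2] at h1
  refine not_smul_idem_nonpos hq hq0 hε ?_
  have := h1.trans hle
  simpa using this

/-- Restriction of an inequality to a smaller idempotent. -/
theorem mul_le_mul_of_idem_le {p q x y : R} (hq : IsIdempotentElem q) (hp : IsIdempotentElem p)
    (hpq : p * q = q) (h : p * x ≤ p * y) : q * x ≤ q * y := by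
  have h2 : q * p = q := by rw [← hp.mul_comm_of_fAlgebra, hpq]
  have h1 := hq.mul_le_mul h
  rwa [← mul_assoc, ← mul_assoc, h2] at h1

theorem mul_le_smul_of_idem_le {p q x : R} {t : ℝ} (hq : IsIdempotentElem q)
    (hp : IsIdempotentElem p) (hpq : p * q = q) (h : p * x ≤ t • p) : q * x ≤ t • q := by
  have := mul_le_mul_of_idem_le (y := t • 1) hq hp hpq (by simpa using h)
  simpa using this

theorem smul_le_mul_of_idem_le {p q x : R} {t : ℝ} (hq : IsIdempotentElem q)
    (hp : IsIdempotentElem p) (hpq : p * q = q) (h : t • p ≤ p * x) : t • q ≤ q * x := by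
  have := mul_le_mul_of_idem_le (x := t • 1) hq hp hpq (by simpa using h)
  simpa using this

/-- Localized dichotomy: either `x ≤ y` on `p`, or `y + ε ≤ x` on a nonzero smaller idempotent. -/
theorem IsIdempotentElem.le_or_gap {p : R} (hp : IsIdempotentElem p) (x y : R) :
    p * x ≤ p * y ∨ ∃ q : R, IsIdempotentElem q ∧ q ≠ 0 ∧ p * q = q ∧
      ∃ ε : ℝ, 0 < ε ∧ q * y + ε • q ≤ q * x := by
  by_cases h : p * x ≤ p * y
  · exact Or.inl h
  obtain ⟨q, hq, h0, ε, hε, hgap⟩ := exists_idem_gap h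
  refine Or.inr ⟨p * q, hp.mul_of_fAlgebra hq, ?_, by rw [← mul_assoc, hp.eq], ε, hε, ?_⟩
  · intro h1
    rw [← mul_assoc, ← mul_assoc, ← hp.mul_comm_of_fAlgebra q, h1] at hgap
    refine not_smul_idem_nonpos hq h0 hε ?_
    simpa using hgap
  · have := hp.mul_le_mul hgap
    rw [hp.mul_comm_of_fAlgebra q]
    rw [mul_add, mul_smul_comm] at this
    have e : ∀ z : R, p * (q * (p * z)) = q * p * z := fun z => by
      rw [← mul_assoc, ← mul_assoc, hp.mul_comm_of_fAlgebra q, mul_assoc q, hp.eq]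
    rw [e, e, hp.mul_comm_of_fAlgebra q] at this
    exact this

/-- Every element is locally bounded above by a real scalar. -/
theorem locally_le_smul (x : R) : Locally fun q : R => ∃ N : ℝ, 1 ≤ N ∧ q * x ≤ N • q := by
  intro p hp h0
  by_contra! hc
  -- If no real bound holds on any idempotent below `p`, then `x` exceeds every `n` on all of `p`,
  -- against the Archimedean property.
  have h : ∀ n : ℕ, n • p ≤ p * |x| := by
    intro n
    rcases hp.le_or_gap (((n : ℝ) + 1) • (1 : R)) x with h1 | ⟨q, hq, hq0, hpq, ε, hε, hgap⟩
    · rw [mul_smul_comm, mul_one] at h1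
      rw [← Nat.cast_smul_eq_nsmul ℝ]
      exact (smul_le_smul_of_nonneg_right (by linarith) hp.nonneg_of_fAlgebra).trans
        (h1.trans (hp.mul_le_mul (le_abs_self x)))
    · refine absurd ?_ (hc q hq hq0 hpq ((n : ℝ) + 1) (by simp))
      rw [mul_smul_comm, mul_one] at hgap
      exact (le_add_of_nonneg_right (smul_nonneg hε.le hq.nonneg_of_fAlgebra)).trans hgap
  exact h0 (le_antisymm (nonpos_of_forall_nsmul_le h) hp.nonneg_of_fAlgebra)

/-- Every element is locally close to a real scalar. -/
theorem locally_approx (x : R) {ε : ℝ} (hε : 0 < ε) :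
    Locally fun q : R => ∃ t : ℝ, (t - ε) • q ≤ q * x ∧ q * x ≤ (t + ε) • q := by
  intro p hp h0
  obtain ⟨q₁, hq₁, hq₁0, hpq₁, N, -, hN⟩ := locally_le_smul x p hp h0
  obtain ⟨q₂, hq₂, hq₂0, hpq₂, M, -, hM⟩ := locally_le_smul (-x) q₁ hq₁ hq₁0
  -- `T` collects the real lower bounds of `x` on nonzero idempotents below `q₂`. An idempotent
  -- nearly attaining `sSup T` works: if `x` exceeded `sSup T + ε` somewhere below it, that number
  -- would belong to `T`.
  let T : Set ℝ := {t | ∃ q : R, IsIdempotentElem q ∧ q ≠ 0 ∧ q₂ * q = q ∧ t • q ≤ q * x}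
  have hM' : -M ∈ T := ⟨q₂, hq₂, hq₂0, hq₂.eq, by
    rw [neg_smul, neg_le]; simpa using hM⟩
  have hT : BddAbove T := by
    refine ⟨N, ?_⟩
    rintro t ⟨q, hq, hq0, hqq, ht⟩
    by_contra! hc
    have h1 : q₁ * q = q := by rw [← hqq, ← mul_assoc, hpq₂]
    have h2 := ht.trans (mul_le_smul_of_idem_le hq hq₁ h1 hN)
    refine not_smul_idem_nonpos hq hq0 (sub_pos.2 hc) ?_
    rw [sub_smul]
    exact sub_nonpos.2 h2
  obtain ⟨t, ⟨q, hq, hq0, hqq, ht⟩, hlt⟩ :=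
    exists_lt_of_lt_csSup ⟨_, hM'⟩ (sub_lt_self (sSup T) hε)
  refine ⟨q, hq, hq0, by rw [← hqq, ← mul_assoc, ← hpq₂, ← mul_assoc, hpq₁], sSup T, ?_, ?_⟩
  · exact (smul_le_smul_of_nonneg_right hlt.le hq.nonneg_of_fAlgebra).trans ht
  · rcases hq.le_or_gap x ((sSup T + ε) • 1) with h1 | ⟨r, hr, hr0, hqr, δ, hδ, hgap⟩
    · simpa using h1
    · exfalso
      have : sSup T + ε ∈ T := by
        refine ⟨r, hr, hr0, by rw [← hqr, ← mul_assoc, hqq], ?_⟩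
        rw [mul_smul_comm, mul_one] at hgap
        exact (le_add_of_nonneg_right (smul_nonneg hδ.le hr.nonneg_of_fAlgebra)).trans hgap
      have := le_csSup hT this
      linarith

theorem IsIdempotentElem.abs_mul_sub_le {q x : R} {t ε : ℝ}
    (h1 : (t - ε) • q ≤ q * x) (h2 : q * x ≤ (t + ε) • q) : |q * x - t • q| ≤ ε • q := by
  rw [abs_le', neg_sub, sub_le_iff_le_add, sub_le_iff_le_add]
  constructor
  · rwa [← add_smul, add_comm]
  · rw [sub_smul, sub_le_iff_le_add] at h1
    rwa [add_comm]

/-- Locally `x` is within `ε` of a real scalar, and scalars commute with `y`, so the commutator is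
at most `2ε|y|`; the Archimedean property removes `ε`. -/
theorem mul_comm_of_fAlgebra (x y : R) : x * y = y * x := by
  suffices h : ∀ x y : R, x * y ≤ y * x from le_antisymm (h x y) (h y x)
  intro x y
  refine le_of_forall_pos_le_add_smul (y := |y| + |y|) fun ε hε => le_of_locally ?_
  refine (locally_approx x hε).mono ?_
  rintro q hq - ⟨t, h1, h2⟩
  have h3 := IsIdempotentElem.abs_mul_sub_le h1 h2
  have hq' := hq.mul_comm_of_fAlgebra
  have e : q * (x * y) = q * (y * x) + ((q * x - t • q) * y + -(y * (q * x - t • q))) := by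
    have e1 : y * (q * x) = q * (y * x) := by rw [← mul_assoc, ← hq' y, mul_assoc]
    rw [sub_mul, mul_sub, e1, smul_mul_assoc, mul_smul_comm, hq' y, ← mul_assoc q x y]
    abel
  have b1 : (q * x - t • q) * y ≤ (ε • q) * |y| :=
    (le_abs_self _).trans ((abs_mul_le_mul_abs _ _).trans
      (mul_le_mul_of_nonneg_right h3 (abs_nonneg y)))
  have b2 : -(y * (q * x - t • q)) ≤ |y| * (ε • q) :=
    (neg_le_abs _).trans ((abs_mul_le_mul_abs _ _).trans
      (mul_le_mul_of_nonneg_left h3 (abs_nonneg y)))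
  rw [e, mul_add]
  refine add_le_add_right ((add_le_add b1 b2).trans (le_of_eq ?_)) _
  rw [smul_mul_assoc, mul_smul_comm, mul_smul_comm, mul_add, smul_add, hq' |y|]

end FAlgebra

/-! ### Order continuity of multiplication and gluing of local bounds -/

section CommFAlgebra

variable {R : Type*} [CommRing R] [Algebra ℝ R] [ConditionallyCompleteLattice R]
  [IsOrderedAddMonoid R] [IsOrderedModule ℝ R] [IsFAlgebra R]

theorem le_of_idem_split {q x y : R} (h1 : q * x ≤ q * y) (h2 : (1 - q) * x ≤ (1 - q) * y) :
    x ≤ y := by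
  calc x = q * x + (1 - q) * x := by ring
    _ ≤ q * y + (1 - q) * y := add_le_add h1 h2
    _ = y := by ring

theorem IsIdempotentElem.mul_le_self {q x : R} (hq : IsIdempotentElem q) (hx : 0 ≤ x) :
    q * x ≤ x := mul_le_of_le_one_left hx hq.le_one_of_fAlgebra

/-- Multiplication by a positive element is order continuous. -/
theorem IsLUB.mul_left_of_fAlgebra {S : Set R} {s r : R} (h : IsLUB S s) (hr : 0 ≤ r) :
    IsLUB ((fun x => r * x) '' S) (r * s) := by
  refine ⟨?_, fun w hw => ?_⟩
  · rintro _ ⟨x, hx, rfl⟩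
    exact mul_le_mul_of_nonneg_left (h.1 hx) hr
  · refine le_of_locally ((locally_le_smul r).mono ?_)
    rintro q hq - ⟨N, hN1, hN⟩
    have hN0 : (0 : ℝ) < N := by linarith
    -- Here `v` is the amount by which `r * s` exceeds the upper bound `w`. Where `r ≤ N`, lowering
    -- `s` by `N⁻¹ • (q * v)` still leaves an upper bound of `S`, so `q * v` must vanish.
    set v := (r * s - w)⁺
    have h1 : ∀ x ∈ S, N⁻¹ • (q * v) ≤ s - x := by
      intro x hx
      have hsx : 0 ≤ s - x := sub_nonneg.2 (h.1 hx)
      have h2 : v ≤ r * (s - x) := by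
        refine sup_le ?_ (mul_nonneg hr hsx)
        rw [mul_sub]
        exact sub_le_sub_left (hw ⟨x, hx, rfl⟩) _
      have h3 : q * v ≤ N • (s - x) :=
        calc q * v ≤ q * (r * (s - x)) := hq.mul_le_mul h2
          _ = (q * r) * (s - x) := (mul_assoc _ _ _).symm
          _ ≤ (N • q) * (s - x) := mul_le_mul_of_nonneg_right hN hsx
          _ = N • (q * (s - x)) := smul_mul_assoc _ _ _
          _ ≤ N • (s - x) := smul_le_smul_of_nonneg_left (hq.mul_le_self hsx) hN0.le
      have := smul_le_smul_of_nonneg_left h3 (inv_pos.2 hN0).le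
      rwa [inv_smul_smul₀ hN0.ne'] at this
    have h4 : s ≤ s - N⁻¹ • (q * v) := h.2 fun x hx => le_sub_comm.1 (h1 x hx)
    have h5 : N⁻¹ • (q * v) ≤ 0 := by simpa using h4
    have h6 : q * v ≤ 0 := by
      have := smul_le_smul_of_nonneg_left h5 hN0.le
      rwa [smul_inv_smul₀ hN0.ne', smul_zero] at this
    have h7 := (hq.mul_le_mul (le_posPart (r * s - w))).trans h6
    rwa [mul_sub, sub_nonpos] at h7

theorem IsGLB.mul_left_of_fAlgebra {S : Set R} {s r : R} (h : IsGLB S s) (hr : 0 ≤ r) :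
    IsGLB ((fun x => r * x) '' S) (r * s) := by
  have h1 := h.neg.mul_left_of_fAlgebra hr
  rw [mul_neg, ← isGLB_neg] at h1
  convert h1 using 1
  · ext x
    simp only [Set.mem_image, Set.mem_neg]
    constructor
    · rintro ⟨y, hy, rfl⟩; exact ⟨-y, by simpa using hy, by simp⟩
    · rintro ⟨y, hy, h⟩; exact ⟨-y, hy, by rw [mul_neg, h, neg_neg]⟩

/-- In a laterally complete `f`-algebra, locally bounded sets are bounded. -/
theorem bddAbove_of_locally [IsLaterallyComplete R] {S : Set R}
    (h : Locally fun q => ∃ N : ℝ, ∀ x ∈ S, q * x ≤ N • q) : BddAbove S := by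
  let F : Set R := {q | IsIdempotentElem q ∧ q ≠ 0 ∧ ∃ N : ℝ, ∀ x ∈ S, q * x ≤ N • q}
  -- A maximal disjoint family of idempotents on which `S` has real bounds. By maximality every
  -- nonzero idempotent meets a member of it.
  obtain ⟨D, hD⟩ := zorn_subset
    {D : Set R | D ⊆ F ∧ ∀ p ∈ D, ∀ q ∈ D, p ≠ q → p * q = 0} (by
    intro c hc hchain
    refine ⟨⋃₀ c, ⟨Set.sUnion_subset fun D hD => (hc hD).1, ?_⟩,
      fun D hD => Set.subset_sUnion_of_mem hD⟩
    rintro p ⟨D₁, hD₁, hp⟩ q ⟨D₂, hD₂, hq⟩ hpq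
    rcases hchain.total hD₁ hD₂ with hle | hle
    · exact (hc hD₂).2 p (hle hp) q hq hpq
    · exact (hc hD₁).2 p hp q (hle hq) hpq)
  obtain ⟨⟨hDF, hDd⟩, hmax⟩ := hD
  have hmeet : ∀ p : R, IsIdempotentElem p → p ≠ 0 → ∃ q ∈ D, p * q ≠ 0 := by
    intro p hp h0
    by_contra! hc
    obtain ⟨q, hq, hq0, hpq, hb⟩ := h p hp h0
    have hqD : ∀ r ∈ D, q * r = 0 := fun r hr => by
      rw [← hpq, mul_comm p, mul_assoc, hc r hr, mul_zero]
    have hmem : q ∈ D := by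
      refine hmax (y := insert q D) ⟨Set.insert_subset ⟨hq, hq0, hb⟩ hDF, ?_⟩
        (Set.subset_insert _ _) (Set.mem_insert _ _)
      rintro r (rfl | hr) t (rfl | ht) hrt
      · exact absurd rfl hrt
      · exact hqD t ht
      · rw [mul_comm]; exact hqD r hr
      · exact hDd r hr t ht hrt
    exact hq0 (hq.eq ▸ hqD q hmem)
  choose! N hN using fun q (hq : q ∈ D) => (hDF hq).2.2
  let f : R → R := fun q => (|N q| • (1 : R)) * q
  have hf0 : ∀ q ∈ D, 0 ≤ f q := fun q hq =>
    mul_nonneg (smul_nonneg (abs_nonneg _) zero_le_one) (hDF hq).1.nonneg_of_fAlgebra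
  -- The bounds `|N q| • q` are pairwise disjoint, so their supremum exists. Inserting `0` keeps the
  -- set nonempty when `D` is empty.
  obtain ⟨s, hs⟩ := IsLaterallyComplete.exists_isLUB (insert 0 (f '' D)) (Set.insert_nonempty _ _)
    (by rintro _ (rfl | ⟨q, hq, rfl⟩); exacts [le_rfl, hf0 q hq])
    (by
      rintro _ (rfl | ⟨p, hp, rfl⟩) _ (rfl | ⟨q, hq, rfl⟩) hne
      · exact absurd rfl hne
      · exact inf_eq_left.2 (hf0 q hq)
      · exact inf_eq_right.2 (hf0 p hp)
      · have hpq : p * q = 0 := hDd p hp q hq fun e => hne (by rw [e])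
        refine inf_eq_zero_of_idem_mul (hDF hp).1 (hf0 p hp) (hf0 q hq) ?_ ?_
        · simp only [f]; rw [mul_left_comm, (hDF hp).1.eq]
        · simp only [f]; rw [mul_left_comm, hpq, mul_zero])
  refine ⟨s, fun x hx => ?_⟩
  by_contra hc
  obtain ⟨p, hp, hp0, ε, hε, hgap⟩ := exists_idem_gap hc
  obtain ⟨q, hq, hpq⟩ := hmeet p hp hp0
  have hqi := (hDF hq).1
  have h1 : q * x ≤ q * s :=
    calc q * x ≤ N q • q := hN q hq x hx
      _ ≤ |N q| • q := smul_le_smul_of_nonneg_right (le_abs_self _) hqi.nonneg_of_fAlgebra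
      _ = q * f q := by simp only [f]; rw [mul_left_comm, hqi.eq, smul_mul_assoc, one_mul]
      _ ≤ q * s := hqi.mul_le_mul (hs.1 (Or.inr ⟨q, hq, rfl⟩))
  have h2 := hqi.mul_le_mul hgap
  have h3 := hp.mul_le_mul h1
  refine not_smul_idem_nonpos (hp.mul_of_fAlgebra hqi) hpq hε ?_
  have h4 : ε • (p * q) = q * (p * s + ε • p) - p * (q * s) := by
    simp only [Algebra.smul_def]; ring
  rw [h4, sub_nonpos]
  refine h2.trans (le_trans (le_of_eq ?_) h3)
  ring

/-! ### Powers, roots and inverses in bands -/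

theorem IsIdempotentElem.mul_pow_of_ne_zero {q : R} (hq : IsIdempotentElem q) (x : R) {n : ℕ}
    (hn : n ≠ 0) : (q * x) ^ n = q * x ^ n := by
  rw [_root_.mul_pow, hq.pow_eq hn]

/-- If `x ≥ y + ε` on an idempotent, then `x ^ n ≥ y ^ n + ε ^ n` there, by superadditivity of the
power on positive elements. -/
theorem le_of_pow_le_pow_of_fAlgebra {x y : R} (hy : 0 ≤ y) {n : ℕ} (hn : n ≠ 0)
    (h : x ^ n ≤ y ^ n) : x ≤ y := by
  by_contra hc
  obtain ⟨p, hp, hp0, ε, hε, hgap⟩ := exists_idem_gap hc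
  have hpy : 0 ≤ p * y := mul_nonneg hp.nonneg_of_fAlgebra hy
  have hεp : 0 ≤ ε • p := smul_nonneg hε.le hp.nonneg_of_fAlgebra
  have h1 : (p * y) ^ n + (ε • p) ^ n ≤ (p * x) ^ n :=
    (pow_add_pow_le hpy hεp hn).trans (pow_le_pow_left₀ (add_nonneg hpy hεp) hgap n)
  rw [hp.mul_pow_of_ne_zero _ hn, hp.mul_pow_of_ne_zero _ hn, smul_pow, hp.pow_eq hn] at h1
  refine not_smul_idem_nonpos hp hp0 (pow_pos hε n) ?_
  have := h1.trans (hp.mul_le_mul h)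
  simpa using this

theorem IsIdempotentElem.mul_le_smul_of_pow {q x : R} (hq : IsIdempotentElem q) {t : ℝ}
    (ht : 0 ≤ t) {n : ℕ} (hn : n ≠ 0) (h : q * x ^ n ≤ t ^ n • q) : q * x ≤ t • q := by
  refine le_of_pow_le_pow_of_fAlgebra (smul_nonneg ht hq.nonneg_of_fAlgebra) hn ?_
  rwa [hq.mul_pow_of_ne_zero _ hn, smul_pow, hq.pow_eq hn]

theorem IsIdempotentElem.mul_pow_le_smul {q x : R} (hq : IsIdempotentElem q) (hx : 0 ≤ x) {t : ℝ}
    {n : ℕ} (h : q * x ≤ t • q) : q * x ^ n ≤ t ^ n • q := by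
  rcases eq_or_ne n 0 with rfl | hn
  · simp
  · rw [← hq.mul_pow_of_ne_zero _ hn]
    refine (pow_le_pow_left₀ (mul_nonneg hq.nonneg_of_fAlgebra hx) h n).trans (le_of_eq ?_)
    rw [smul_pow, hq.pow_eq hn]

/-- A one-sided Lipschitz estimate for the `n`-th power below the level `N`. The constant `n * N ^
n` is cruder than `n * N ^ (n - 1)` but makes the induction uniform. -/
theorem IsIdempotentElem.mul_pow_le_add {q x y : R} (hq : IsIdempotentElem q) (hx : 0 ≤ x)
    (hy : 0 ≤ y) {N η : ℝ} (hN : 1 ≤ N) (hη : 0 ≤ η) (hxN : q * x ≤ N • q) (hyN : q * y ≤ N • q)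
    (h : q * x ≤ q * y + η • q) (n : ℕ) :
    q * x ^ n ≤ q * y ^ n + (n * N ^ n * η) • q := by
  induction n with
  | zero => simp
  | succ n ih =>
    have hN0 : (0 : ℝ) ≤ N := by linarith
    have h1 : q * x ^ (n + 1) ≤ (q * y ^ n) * x + ((n * N ^ n * η) • q) * x := by
      rw [pow_succ, ← mul_assoc, ← add_mul]
      exact mul_le_mul_of_nonneg_right ih hx
    have h2 : (q * y ^ n) * x ≤ q * y ^ (n + 1) + (N ^ n * η) • q := by
      calc (q * y ^ n) * x = y ^ n * (q * x) := by ring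
        _ ≤ y ^ n * (q * y + η • q) := mul_le_mul_of_nonneg_left h (pow_nonneg hy n)
        _ = q * y ^ (n + 1) + η • (q * y ^ n) := by simp only [Algebra.smul_def]; ring
        _ ≤ q * y ^ (n + 1) + η • (N ^ n • q) :=
          add_le_add_right (smul_le_smul_of_nonneg_left (hq.mul_pow_le_smul hy hyN) hη) _
        _ = q * y ^ (n + 1) + (N ^ n * η) • q := by rw [smul_smul, mul_comm η]
    have h3 : ((n * N ^ n * η) • q) * x ≤ (n * N ^ n * η * N) • q := by
      rw [smul_mul_assoc, mul_smul (n * N ^ n * η) N q]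
      exact smul_le_smul_of_nonneg_left hxN (by positivity)
    have h4 : (N ^ n * η + n * N ^ n * η * N) • q ≤ ((n + 1 : ℕ) * N ^ (n + 1) * η) • q := by
      refine smul_le_smul_of_nonneg_right ?_ hq.nonneg_of_fAlgebra
      have : N ^ n * η ≤ N ^ n * η * N := le_mul_of_one_le_right (by positivity) hN
      push_cast
      calc _ ≤ N ^ n * η * N + n * N ^ n * η * N := by linarith
        _ = _ := by ring
    calc _ ≤ _ := h1
      _ ≤ (q * y ^ (n + 1) + (N ^ n * η) • q) + (n * N ^ n * η * N) • q := add_le_add h2 h3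
      _ = q * y ^ (n + 1) + (N ^ n * η + n * N ^ n * η * N) • q := by rw [add_smul, add_assoc]
      _ ≤ _ := add_le_add_right h4 _

/-- Positive elements of a Dedekind complete unital `f`-algebra have positive `n`-th roots. -/
theorem exists_nonneg_pow_eq {a : R} (ha : 0 ≤ a) {n : ℕ} (hn : n ≠ 0) :
    ∃ r : R, 0 ≤ r ∧ r ^ n = a := by
  -- The root is the supremum of `S`; the bound `1 + a` works because `a ≤ 1 + a ≤ (1 + a) ^ n`.
  let S : Set R := {y | 0 ≤ y ∧ y ^ n ≤ a}
  have h0S : (0 : R) ∈ S := ⟨le_rfl, by rwa [zero_pow hn]⟩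
  have hb : BddAbove S := by
    have h1 : (0 : R) ≤ 1 + a := add_nonneg zero_le_one ha
    refine ⟨1 + a, fun y hy => le_of_pow_le_pow_of_fAlgebra h1 hn (hy.2.trans ?_)⟩
    exact (le_add_of_nonneg_left zero_le_one).trans
      (le_self_pow₀ (le_add_of_nonneg_right ha) hn)
  have hx : IsLUB S (sSup S) := isLUB_csSup ⟨0, h0S⟩ hb
  set x := sSup S
  have hx0 : 0 ≤ x := hx.1 h0S
  have hxa : x ^ n ≤ a := by
    by_contra hc
    obtain ⟨p, hp, hp0, ε, hε, hgap⟩ := exists_idem_gap hc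
    obtain ⟨q, hq, hq0, hpq, N, hN1, hN⟩ := locally_le_smul x p hp hp0
    have hN0 : (0 : ℝ) < N := by linarith
    -- Chosen so that replacing `x` by some `y ∈ S` within `η` of it changes the `n`-th power by at
    -- most `ε / 2`.
    set η : ℝ := ε / (2 * (n * N ^ n + 1)) with hηdef
    have hη : 0 < η := by positivity
    have hnot : ¬ ∀ y ∈ S, y ≤ x - η • q := fun hall => by
      have := hx.2 hall
      exact not_smul_idem_nonpos hq hq0 hη (by simpa using this)
    push Not at hnot
    obtain ⟨y, hy, hyx⟩ := hnot
    obtain ⟨r, hr, hr0, δ, hδ, hgap'⟩ := exists_idem_gap hyx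
    have hrq : IsIdempotentElem (r * q) := hr.mul_of_fAlgebra hq
    have hrq0 : r * q ≠ 0 := fun h0 => by
      rw [mul_sub, mul_smul_comm, h0, smul_zero, sub_zero] at hgap'
      have := hgap'.trans (hr.mul_le_mul (hx.1 hy))
      exact not_smul_idem_nonpos hr hr0 hδ (by simpa using this)
    have hqrq : q * (r * q) = r * q := by rw [mul_left_comm, hq.eq]
    have hprq : p * (r * q) = r * q := by rw [mul_left_comm, hpq]
    have h1 : r * q * x ≤ r * q * y + η • (r * q) := by
      have h2 := (le_add_of_nonneg_right (smul_nonneg hδ.le hr.nonneg_of_fAlgebra)).trans hgap'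
      have h3 := hq.mul_le_mul h2
      rw [← sub_le_iff_le_add]
      calc r * q * x - η • (r * q) = q * (r * (x - η • q)) := by
            have : η • (r * q) = η • (r * (q * q)) := by rw [hq.eq]
            rw [this]; simp only [Algebra.smul_def]; ring
        _ ≤ q * (r * y) := h3
        _ = r * q * y := by ring
    have hxN := mul_le_smul_of_idem_le hrq hq hqrq hN
    have h4 := hrq.mul_pow_le_add hx0 hy.1 hN1 hη.le hxN
      ((hrq.mul_le_mul (hx.1 hy)).trans hxN) h1 n
    have h5 := mul_le_mul_of_idem_le (x := a + ε • 1) hrq hp hprq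
      (by simpa [mul_add] using hgap)
    have h6 : (ε / 2) • (r * q) ≤ 0 := by
      have h7 : n * N ^ n * η ≤ ε / 2 := by
        rw [hηdef, ← mul_div_assoc, div_le_div_iff₀ (by positivity) (by positivity)]
        nlinarith [pow_pos hN0 n]
      have h8 := smul_le_smul_of_nonneg_right h7 hrq.nonneg_of_fAlgebra
      have h9 := h5.trans (h4.trans (add_le_add (hrq.mul_le_mul hy.2) h8))
      rw [mul_add, mul_smul_comm, mul_one, add_le_add_iff_left] at h9
      have e : (ε / 2) • (r * q) = ε • (r * q) - (ε / 2) • (r * q) := by module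
      rw [e]
      exact sub_nonpos.2 h9
    exact not_smul_idem_nonpos hrq hrq0 (half_pos hε) h6
  refine ⟨x, hx0, le_antisymm hxa ?_⟩
  · by_contra hc
    obtain ⟨p, hp, hp0, ε, hε, hgap⟩ := exists_idem_gap hc
    obtain ⟨q, hq, hq0, hpq, N, hN1, hN⟩ := locally_le_smul x p hp hp0
    have hN0 : (0 : ℝ) < N := by linarith
    -- The entry `1` keeps `x + η • q` below `N + 1` on `q`; the other makes the increase of the
    -- `n`-th power at most `ε`. So `x + η • q` still lies in `S`, against the choice of `x`.
    set η : ℝ := min 1 (ε / (n * (N + 1) ^ n + 1)) with hηdef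
    have hη : 0 < η := lt_min one_pos (by positivity)
    have hηq : 0 ≤ η • q := smul_nonneg hη.le hq.nonneg_of_fAlgebra
    have e1 : q * (x + η • q) = q * x + η • q := by rw [mul_add, mul_smul_comm, hq.eq]
    have h1 := hq.mul_pow_le_add (x := x + η • q) (y := x) (add_nonneg hx0 hηq) hx0
      (N := N + 1) (by linarith) hη.le
      (by
        rw [e1, add_smul]
        exact add_le_add hN (smul_le_smul_of_nonneg_right (min_le_left _ _) hq.nonneg_of_fAlgebra))
      (hN.trans (smul_le_smul_of_nonneg_right (by linarith) hq.nonneg_of_fAlgebra)) e1.le n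
    have h5 := mul_le_mul_of_idem_le (x := x ^ n + ε • 1) hq hp hpq
      (by simpa [mul_add] using hgap)
    have h7 : n * (N + 1) ^ n * η ≤ ε := by
      have : η * (n * (N + 1) ^ n + 1) ≤ ε := by
        rw [← le_div_iff₀ (by positivity)]; exact min_le_right _ _
      nlinarith
    have hmem : x + η • q ∈ S := by
      refine ⟨add_nonneg hx0 hηq, le_of_idem_split (q := q) ?_ ?_⟩
      · refine h1.trans (le_trans ?_ h5)
        rw [mul_add, mul_smul_comm, mul_one]
        exact add_le_add_right (smul_le_smul_of_nonneg_right h7 hq.nonneg_of_fAlgebra) _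
      · have hq' := hq.one_sub
        rw [← hq'.mul_pow_of_ne_zero _ hn, mul_add, mul_smul_comm, hq.one_sub_mul_self, smul_zero,
          add_zero, hq'.mul_pow_of_ne_zero _ hn]
        exact hq'.mul_le_mul hxa
    exact not_smul_idem_nonpos hq hq0 hη (by simpa using hx.1 hmem)

/-- Below any nonzero idempotent of its band, a positive element is locally bounded away from
zero. -/
theorem exists_smul_le_mul_of_ne_zero {a p : R} (hp : IsIdempotentElem p)
    (h : p * bandProj a 1 ≠ 0) (ha : 0 ≤ a) :
    ∃ q : R, IsIdempotentElem q ∧ q ≠ 0 ∧ p * q = q ∧ ∃ ε : ℝ, 0 < ε ∧ ε • q ≤ q * a := by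
  rcases hp.le_or_gap a 0 with h1 | ⟨q, hq, hq0, hpq, ε, hε, hgap⟩
  · refine absurd (hp.mul_bandProj_one_eq_zero (le_antisymm ?_ ?_)) h
    · simpa using h1
    · exact mul_nonneg hp.nonneg_of_fAlgebra ha
  · exact ⟨q, hq, hq0, hpq, ε, hε, by simpa using hgap⟩

/-- Positive elements of a universally complete `f`-algebra are invertible in the band they
generate. -/
theorem exists_isBandInverse [IsLaterallyComplete R] {a : R} (ha : 0 ≤ a) :
    ∃ y : R, 0 ≤ y ∧ IsBandInverse a y := by
  set e := bandProj a 1 with he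
  have hei : IsIdempotentElem e := isIdempotentElem_bandProj_one a
  -- The inverse is the largest `y` in the band with `a * y ≤ e`. Members of `S` vanish off `e`, and
  -- where `a ≥ ε` they are at most `ε⁻¹`, so `S` is locally bounded.
  let S : Set R := {y | 0 ≤ y ∧ e * y = y ∧ a * y ≤ e}
  have h0S : (0 : R) ∈ S := ⟨le_rfl, mul_zero _, by rw [mul_zero]; exact hei.nonneg_of_fAlgebra⟩
  have hb : BddAbove S := by
    refine bddAbove_of_locally fun p hp hp0 => ?_
    by_cases h : p * e = 0
    · refine ⟨p, hp, hp0, hp.eq, 0, fun y hy => ?_⟩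
      rw [← hy.2.1, ← mul_assoc, h, zero_mul, zero_smul]
    · obtain ⟨q, hq, hq0, hpq, ε, hε, hle⟩ := exists_smul_le_mul_of_ne_zero hp h ha
      refine ⟨q, hq, hq0, hpq, ε⁻¹, fun y hy => ?_⟩
      have h1 : ε • (q * y) ≤ q :=
        calc ε • (q * y) = (ε • q) * y := (smul_mul_assoc _ _ _).symm
          _ ≤ (q * a) * y := mul_le_mul_of_nonneg_right hle hy.1
          _ = q * (a * y) := mul_assoc _ _ _
          _ ≤ q * 1 := hq.mul_le_mul (hy.2.2.trans hei.le_one_of_fAlgebra)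
          _ = q := mul_one q
      have := smul_le_smul_of_nonneg_left h1 (inv_pos.2 hε).le
      rwa [inv_smul_smul₀ hε.ne'] at this
  have hx : IsLUB S (sSup S) := isLUB_csSup ⟨0, h0S⟩ hb
  set x := sSup S
  have hx0 : 0 ≤ x := hx.1 h0S
  have hex : e * x = x := by
    refine (hx.mul_left_of_fAlgebra hei.nonneg_of_fAlgebra).unique ?_
    convert hx using 1
    ext y
    constructor
    · rintro ⟨z, hz, rfl⟩; simpa only [hz.2.1] using hz
    · intro hy; exact ⟨y, hy, hy.2.1⟩
  have hax : a * x ≤ e := by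
    refine (hx.mul_left_of_fAlgebra ha).2 ?_
    rintro _ ⟨y, hy, rfl⟩
    exact hy.2.2
  have hax' : e ≤ a * x := by
    by_contra hc
    obtain ⟨p, hp, hp0, ε, hε, hgap⟩ := exists_idem_gap hc
    obtain ⟨q, hq, hq0, hpq, N, hN1, hN⟩ := locally_le_smul a p hp hp0
    have hN0 : (0 : ℝ) < N := by linarith
    have hqe : IsIdempotentElem (q * e) := hq.mul_of_fAlgebra hei
    have hgap' := mul_le_mul_of_idem_le (x := a * x + ε • 1) hq hp hpq
      (by simpa [mul_add] using hgap)
    rw [mul_add, mul_smul_comm, mul_one] at hgap'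
    -- Since `a ≤ N` on `q`, adding `(ε / N) • (q * e)` to `x` raises `a * x` by at most `ε` on `q`,
    -- which the gap leaves room for.
    have hδ : 0 < ε / N := by positivity
    have h1 : a * ((ε / N) • (q * e)) ≤ ε • (q * e) :=
      calc a * ((ε / N) • (q * e)) = (ε / N) • ((q * a) * e) := by
            simp only [Algebra.smul_def]; ring
        _ ≤ (ε / N) • ((N • q) * e) := smul_le_smul_of_nonneg_left
            (mul_le_mul_of_nonneg_right hN hei.nonneg_of_fAlgebra) hδ.le
        _ = ε • (q * e) := by rw [smul_mul_assoc, smul_smul, div_mul_cancel₀ _ hN0.ne']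
    have hmem : x + (ε / N) • (q * e) ∈ S := by
      refine ⟨add_nonneg hx0 (smul_nonneg hδ.le hqe.nonneg_of_fAlgebra), ?_, ?_⟩
      · rw [mul_add, hex, mul_smul_comm, mul_left_comm, hei.eq]
      · rw [mul_add]
        refine (add_le_add_right h1 _).trans (le_of_idem_split (q := q) ?_ ?_)
        · refine le_trans ?_ hgap'
          rw [mul_add, mul_smul_comm, ← mul_assoc q q e, hq.eq]
          exact add_le_add_right (smul_le_smul_of_nonneg_left
            (mul_le_of_le_one_right hq.nonneg_of_fAlgebra hei.le_one_of_fAlgebra) hε.le) _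
        · rw [mul_add, mul_smul_comm, ← mul_assoc (1 - q) q e, hq.one_sub_mul_self, zero_mul,
            smul_zero, add_zero]
          exact hq.one_sub.mul_le_mul hax
    have hqe0 : q * e = 0 := by
      by_contra h0
      exact not_smul_idem_nonpos hqe h0 hδ (by simpa using hx.1 hmem)
    rw [hqe0] at hgap'
    refine not_smul_idem_nonpos hq hq0 hε (le_trans (le_add_of_nonneg_left ?_) hgap')
    exact mul_nonneg hq.nonneg_of_fAlgebra (mul_nonneg ha hx0)
  have hinv : a * x = e := le_antisymm hax hax'
  exact ⟨x, hx0, mem_principalBand_iff.2 hex, hinv, (mul_comm _ _).trans hinv⟩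

theorem isWeakOrderUnit_iff {u : R} (hu : 0 ≤ u) : IsWeakOrderUnit u ↔ bandProj u 1 = 1 := by
  constructor
  · intro h
    have h1 : (1 : R) ∈ principalBand u := h.2 ▸ Submodule.mem_top
    simpa using mem_principalBand_iff.1 h1
  · refine fun h => ⟨hu, eq_top_iff.2 fun x _ => mem_principalBand_iff.2 ?_⟩
    rw [h, one_mul]

theorem isWeakOrderUnit_of_mul_eq_one {u v : R} (hu : 0 ≤ u) (h : u * v = 1) :
    IsWeakOrderUnit u := by
  rw [isWeakOrderUnit_iff hu]
  calc bandProj u 1 = bandProj u 1 * (u * v) := by rw [h, mul_one]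
    _ = 1 := by rw [← mul_assoc, bandProj_one_mul_self, h]

/-! ### The modulus on the complexification -/

namespace Cplx

theorem le_modulus (x : Cplx R) (θ : ℝ) : Real.cos θ • x.re + Real.sin θ • x.im ≤ x.modulus := by
  refine x.isLUB_modulus.1 ⟨toIcoMod Real.two_pi_pos 0 θ, ?_, ?_⟩
  · have := toIcoMod_mem_Ico Real.two_pi_pos 0 θ
    rw [zero_add] at this
    exact ⟨this.1, this.2.le⟩
  · simp only [toIcoMod, zsmul_eq_mul, Real.cos_sub_int_mul_two_pi, Real.sin_sub_int_mul_two_pi]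

theorem modulus_le {x : Cplx R} {u : R}
    (h : ∀ θ : ℝ, Real.cos θ • x.re + Real.sin θ • x.im ≤ u) : x.modulus ≤ u :=
  x.isLUB_modulus.2 (by rintro _ ⟨θ, -, rfl⟩; exact h θ)

theorem abs_combination_le_modulus (x : Cplx R) (θ : ℝ) :
    |Real.cos θ • x.re + Real.sin θ • x.im| ≤ x.modulus := by
  refine abs_le'.2 ⟨x.le_modulus θ, le_trans (le_of_eq ?_) (x.le_modulus (θ + Real.pi))⟩
  rw [Real.cos_add_pi, Real.sin_add_pi]
  module

theorem abs_re_le_modulus (x : Cplx R) : |x.re| ≤ x.modulus := by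
  simpa using x.abs_combination_le_modulus 0

theorem abs_im_le_modulus (x : Cplx R) : |x.im| ≤ x.modulus := by
  simpa using x.abs_combination_le_modulus (Real.pi / 2)

theorem modulus_nonneg (x : Cplx R) : 0 ≤ x.modulus :=
  (abs_nonneg _).trans x.abs_re_le_modulus

theorem modulus_zero : (0 : Cplx R).modulus = 0 :=
  le_antisymm (modulus_le fun θ => by simp) (modulus_nonneg _)

theorem modulus_add_le (x y : Cplx R) : (x + y).modulus ≤ x.modulus + y.modulus := by
  refine modulus_le fun θ => le_trans (le_of_eq ?_) (add_le_add (x.le_modulus θ) (y.le_modulus θ))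
  rw [add_re, add_im]
  module

theorem modulus_neg (x : Cplx R) : (-x).modulus = x.modulus := by
  have h : ∀ x : Cplx R, (-x).modulus ≤ x.modulus := fun x =>
    modulus_le fun θ => le_trans (le_of_eq (by rw [neg_re, neg_im]; module))
      ((neg_le_abs _).trans (x.abs_combination_le_modulus θ))
  exact le_antisymm (h x) (by simpa using h (-x))

theorem modulus_sub_le (x y : Cplx R) : (x - y).modulus ≤ x.modulus + y.modulus := by
  rw [sub_eq_add_neg, ← modulus_neg y]
  exact modulus_add_le _ _

theorem modulus_sum_le {ι : Type*} (s : Finset ι) (f : ι → Cplx R) :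
    (∑ i ∈ s, f i).modulus ≤ ∑ i ∈ s, (f i).modulus := by
  classical
  induction s using Finset.induction_on with
  | empty => simp [modulus_zero]
  | insert i s hi ih =>
    rw [Finset.sum_insert hi, Finset.sum_insert hi]
    exact (modulus_add_le _ _).trans (add_le_add_right ih _)

theorem modulus_ofReal_le {r : R} (hr : 0 ≤ r) : (⟨r, 0⟩ : Cplx R).modulus ≤ r :=
  modulus_le fun θ => by
    have := smul_le_smul_of_nonneg_right (Real.cos_le_one θ) hr
    simpa using this

theorem ofReal_pow (r : R) (n : ℕ) : (⟨r, 0⟩ : Cplx R) ^ n = ⟨r ^ n, 0⟩ := by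
  induction n with
  | zero => simp only [pow_zero]; rfl
  | succ n ih => rw [pow_succ, ih]; ext <;> simp [pow_succ]

/-- Locally `x` is close to a complex number `ρ e^{iφ}`, and multiplication by it rotates `y` by `φ`
and scales by `ρ`. Approximating the two parts of `x` costs `2ε|y|`, and comparing `ρ` with `|x|`
costs another `2ε|y|`. -/
theorem modulus_mul_le (x y : Cplx R) : (x * y).modulus ≤ x.modulus * y.modulus := by
  refine modulus_le fun θ => ?_
  refine le_of_forall_pos_le_add_smul (y := (4 : ℝ) • y.modulus) fun ε hε => le_of_locally ?_
  have hX := locally_approx x.re hε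
  have hY := locally_approx x.im hε
  refine (hX.and hY ?_).mono ?_
  · rintro p q hp hq hpq ⟨t, h1, h2⟩
    exact ⟨t, smul_le_mul_of_idem_le hq hp hpq h1, mul_le_smul_of_idem_le hq hp hpq h2⟩
  rintro q hq - ⟨⟨s, hs1, hs2⟩, t, ht1, ht2⟩
  have hs := IsIdempotentElem.abs_mul_sub_le hs1 hs2
  have ht := IsIdempotentElem.abs_mul_sub_le ht1 ht2
  obtain ⟨ρ, φ, hρ, rfl, rfl⟩ : ∃ ρ φ : ℝ, 0 ≤ ρ ∧ s = ρ * Real.cos φ ∧ t = ρ * Real.sin φ :=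
    ⟨‖(⟨s, t⟩ : ℂ)‖, Complex.arg ⟨s, t⟩, norm_nonneg _, by rw [Complex.norm_mul_cos_arg],
      by rw [Complex.norm_mul_sin_arg]⟩
  set Y := y.modulus
  have hY0 : 0 ≤ Y := modulus_nonneg y
  -- The real combination of `x * y` at angle `θ` equals `x.re * A + x.im * B`, and `cos φ • A + sin
  -- φ • B` is the combination of `y` at angle `θ - φ`.
  set A := Real.cos θ • y.re + Real.sin θ • y.im with hA
  set B := Real.sin θ • y.re - Real.cos θ • y.im with hB
  have hAY : |A| ≤ Y := y.abs_combination_le_modulus θ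
  have hBY : |B| ≤ Y := by
    have := y.abs_combination_le_modulus (θ - Real.pi / 2)
    rw [Real.cos_sub_pi_div_two, Real.sin_sub_pi_div_two, neg_smul, ← sub_eq_add_neg] at this
    exact this
  have hC : Real.cos φ • A + Real.sin φ • B ≤ Y := by
    refine le_trans (le_of_eq ?_) (y.le_modulus (θ - φ))
    rw [Real.cos_sub, Real.sin_sub, hA, hB]
    module
  set u := q * x.re - (ρ * Real.cos φ) • q
  set v := q * x.im - (ρ * Real.sin φ) • q
  have hεq : 0 ≤ ε • q := smul_nonneg hε.le hq.nonneg_of_fAlgebra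
  have hu : u * A ≤ (ε • q) * Y := (le_abs_self _).trans ((abs_mul_le_mul_abs _ _).trans
    (mul_le_mul hs hAY (abs_nonneg _) hεq))
  have hv : v * B ≤ (ε • q) * Y := (le_abs_self _).trans ((abs_mul_le_mul_abs _ _).trans
    (mul_le_mul ht hBY (abs_nonneg _) hεq))
  have hscal : ∀ (c : ℝ) (w : R), |c| ≤ 1 → |w| ≤ ε • q → -(c • w) ≤ ε • q := by
    intro c w hc hw
    have h1 : -(c • w) ≤ |c • (1 : R)| * |w| := by
      refine le_trans (neg_le_abs _) ?_
      simpa using abs_mul_le_mul_abs (c • (1 : R)) w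
    have h2 : |c • (1 : R)| ≤ 1 := by
      obtain ⟨h3, h4⟩ := abs_le.1 hc
      refine abs_le'.2 ⟨?_, ?_⟩
      · simpa using smul_le_smul_of_nonneg_right h4 (zero_le_one : (0 : R) ≤ 1)
      · rw [← neg_smul]
        simpa using smul_le_smul_of_nonneg_right (neg_le.1 h3) (zero_le_one : (0 : R) ≤ 1)
    exact h1.trans ((mul_le_of_le_one_left (abs_nonneg _) h2).trans hw)
  have hρq : ρ • q ≤ q * x.modulus + ((2 : ℝ) * ε) • q := by
    have h1 := hq.mul_le_mul (x.le_modulus φ)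
    have h2 := hscal _ u (Real.abs_cos_le_one φ) hs
    have h3 := hscal _ v (Real.abs_sin_le_one φ) ht
    have e : ρ • q = q * (Real.cos φ • x.re + Real.sin φ • x.im) +
        (-(Real.cos φ • u) + -(Real.sin φ • v)) := by
      have h4 : ρ • q = (ρ * (Real.cos φ ^ 2 + Real.sin φ ^ 2)) • q := by
        rw [Real.cos_sq_add_sin_sq, mul_one]
      rw [h4, mul_add q, mul_smul_comm, mul_smul_comm]
      simp only [u, v]
      module
    rw [e]
    refine add_le_add h1 ((add_le_add h2 h3).trans (le_of_eq ?_))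
    module
  have hmain : (ρ • q) * (Real.cos φ • A + Real.sin φ • B) ≤
      (q * x.modulus + ((2 : ℝ) * ε) • q) * Y :=
    (mul_le_mul_of_nonneg_left hC (smul_nonneg hρ hq.nonneg_of_fAlgebra)).trans
      (mul_le_mul_of_nonneg_right hρq hY0)
  calc q * (Real.cos θ • (x * y).re + Real.sin θ • (x * y).im)
      = u * A + v * B + (ρ • q) * (Real.cos φ • A + Real.sin φ • B) := by
        simp only [u, v, hA, hB, mul_re, mul_im, Algebra.smul_def, map_mul]
        ring
    _ ≤ (ε • q) * Y + (ε • q) * Y + (q * x.modulus + ((2 : ℝ) * ε) • q) * Y :=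
        add_le_add (add_le_add hu hv) hmain
    _ = q * (x.modulus * Y + ε • (4 : ℝ) • Y) := by
        rw [show (4 : ℝ) = 2 + 1 + 1 by norm_num]
        simp only [Algebra.smul_def, map_mul, map_add, map_one]
        ring

/-- Multiplication by `r ≥ 0` passes through the supremum defining the modulus. This direction
recovers `|a_n| r^n` from the term of the series at `z = c + r`. -/
theorem modulus_mul_ofReal {r : R} (hr : 0 ≤ r) (x : Cplx R) :
    x.modulus * r ≤ (x * ⟨r, 0⟩ : Cplx R).modulus := by
  rw [mul_comm]
  refine (x.isLUB_modulus.mul_left_of_fAlgebra hr).2 ?_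
  rintro _ ⟨_, ⟨θ, -, rfl⟩, rfl⟩
  refine le_trans (le_of_eq ?_) (le_modulus _ θ)
  simp only [mul_re, mul_im, Algebra.smul_def]
  ring

theorem modulus_mul_pow_le (x y : Cplx R) {r : R} (hy : y.modulus ≤ r) (n : ℕ) :
    (x * y ^ n).modulus ≤ x.modulus * r ^ n := by
  have hr : 0 ≤ r := (modulus_nonneg y).trans hy
  induction n with
  | zero => simp
  | succ n ih =>
    rw [pow_succ, ← mul_assoc, pow_succ, ← mul_assoc]
    exact (modulus_mul_le _ _).trans (mul_le_mul ih hy (modulus_nonneg _)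
      (mul_nonneg (modulus_nonneg _) (pow_nonneg hr n)))

end Cplx

end CommFAlgebra

/-! ### Limits superior and order limits -/

section Limsup

variable {R : Type*} [CommRing R] [Algebra ℝ R] [ConditionallyCompleteLattice R]
  [IsOrderedAddMonoid R] [IsOrderedModule ℝ R] [IsFAlgebra R]

theorem isLUB_tail {x : ℕ → R} (hb : BddAbove (Set.range x)) (n : ℕ) :
    IsLUB (x '' Set.Ici n) (⨆ m : Set.Ici n, x m) := by
  rw [Set.image_eq_range]
  exact isLUB_ciSup (hb.mono (by rintro _ ⟨m, rfl⟩; exact ⟨m, rfl⟩))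

theorem le_tail {x : ℕ → R} (hb : BddAbove (Set.range x)) {n m : ℕ} (h : n ≤ m) :
    x m ≤ ⨆ m : Set.Ici n, x m := (isLUB_tail hb n).1 ⟨m, h, rfl⟩

theorem isGLB_orderLimsup {x : ℕ → R} (h0 : ∀ k, 0 ≤ x k) (hb : BddAbove (Set.range x)) :
    IsGLB (Set.range fun n : ℕ => ⨆ m : Set.Ici n, x m) (orderLimsup x) :=
  isGLB_ciInf ⟨0, by rintro _ ⟨n, rfl⟩; exact (h0 n).trans (le_tail hb le_rfl)⟩

theorem orderLimsup_nonneg {x : ℕ → R} (h0 : ∀ k, 0 ≤ x k) (hb : BddAbove (Set.range x)) :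
    0 ≤ orderLimsup x :=
  (isGLB_orderLimsup h0 hb).2
    (by rintro _ ⟨n, rfl⟩; exact (h0 n).trans (le_tail hb le_rfl))

theorem orderLimsup_mul_left {x : ℕ → R} (h0 : ∀ k, 0 ≤ x k) (hb : BddAbove (Set.range x))
    {r : R} (hr : 0 ≤ r) : (orderLimsup fun k => r * x k) = r * orderLimsup x := by
  have hb' : BddAbove (Set.range fun k => r * x k) := by
    obtain ⟨B, hB⟩ := hb
    refine ⟨r * B, ?_⟩
    rintro _ ⟨k, rfl⟩
    exact mul_le_mul_of_nonneg_left (hB ⟨k, rfl⟩) hr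
  have htail : ∀ n : ℕ, (⨆ m : Set.Ici n, r * x m) = r * ⨆ m : Set.Ici n, x m := fun n => by
    refine (isLUB_tail hb' n).unique ?_
    have := (isLUB_tail hb n).mul_left_of_fAlgebra hr
    rwa [Set.image_image] at this
  have h1 := isGLB_orderLimsup (fun k => mul_nonneg hr (h0 k)) hb'
  have h2 := (isGLB_orderLimsup h0 hb).mul_left_of_fAlgebra hr
  rw [← Set.range_comp] at h2
  simp only [htail] at h1
  exact h1.unique h2

/-- A local eventual bound for a sequence bounds its limit superior. -/
theorem orderLimsup_le_of_locally {x : ℕ → R} (h0 : ∀ k, 0 ≤ x k) (hb : BddAbove (Set.range x))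
    {t : ℝ} (h : Locally fun q => ∃ n : ℕ, ∀ k ≥ n, q * x k ≤ t • q) :
    orderLimsup x ≤ t • 1 := by
  refine le_of_locally (h.mono ?_)
  rintro q hq - ⟨n, hn⟩
  refine (hq.mul_le_mul ((isGLB_orderLimsup h0 hb).1 ⟨n, rfl⟩)).trans ?_
  refine ((isLUB_tail hb n).mul_left_of_fAlgebra hq.nonneg_of_fAlgebra).2 ?_
  rintro _ ⟨_, ⟨k, hk, rfl⟩, rfl⟩
  simpa using hn k hk

/-- A bound for the limit superior gives a local eventual bound for the sequence. -/
theorem locally_le_of_orderLimsup_le {x : ℕ → R} (h0 : ∀ k, 0 ≤ x k)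
    (hb : BddAbove (Set.range x)) {s t : ℝ} (hts : t < s) (h : orderLimsup x ≤ t • 1) :
    Locally fun q => ∃ n : ℕ, ∀ k ≥ n, q * x k ≤ s • q := by
  intro p hp hp0
  by_contra! hc
  -- Without an eventual bound on any idempotent below `p`, every tail supremum is at least `s` on
  -- `p`, hence so is the limit superior, against `t < s`.
  have h1 : ∀ n : ℕ, s • p ≤ ⨆ m : Set.Ici n, x m := by
    intro n
    have hu0 : 0 ≤ ⨆ m : Set.Ici n, x m := (h0 n).trans (le_tail hb le_rfl)
    rcases hp.le_or_gap (s • (1 : R)) (⨆ m : Set.Ici n, x m) with h2 | ⟨q, hq, hq0, hpq, ε, hε, h2⟩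
    · rw [mul_smul_comm, mul_one] at h2
      exact h2.trans (hp.mul_le_self hu0)
    · obtain ⟨k, hk, hkq⟩ := hc q hq hq0 hpq n
      refine absurd ?_ hkq
      rw [mul_smul_comm, mul_one] at h2
      exact (hq.mul_le_mul (le_tail hb hk)).trans
        ((le_add_of_nonneg_right (smul_nonneg hε.le hq.nonneg_of_fAlgebra)).trans h2)
  have h2 : s • p ≤ orderLimsup x :=
    (isGLB_orderLimsup h0 hb).2 (by rintro _ ⟨n, rfl⟩; exact h1 n)
  have h3 := hp.mul_le_mul (h2.trans h)
  rw [mul_smul_comm, mul_smul_comm, mul_one, hp.eq] at h3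
  refine not_smul_idem_nonpos hp hp0 (sub_pos.2 hts) ?_
  rw [sub_smul]
  exact sub_nonpos.2 h3

/-- This is the fact `N^(1/n) → 1`, used locally and without roots of `N`: eventually `N < (1 + δ) ^
n`, while `N ≤ N ^ (k + 1)` gives boundedness. -/
theorem bddAbove_and_orderLimsup_le_one [IsLaterallyComplete R] {x : ℕ → R} (h0 : ∀ k, 0 ≤ x k)
    (h : Locally fun q => ∃ N : ℝ, 1 ≤ N ∧ ∀ k, q * x k ^ (k + 1) ≤ N • q) :
    BddAbove (Set.range x) ∧ orderLimsup x ≤ 1 := by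
  have hb : BddAbove (Set.range x) := by
    refine bddAbove_of_locally (h.mono ?_)
    rintro q hq - ⟨N, hN1, hN⟩
    refine ⟨N, ?_⟩
    rintro _ ⟨k, rfl⟩
    exact hq.mul_le_smul_of_pow (by linarith) (Nat.succ_ne_zero k) ((hN k).trans
      (smul_le_smul_of_nonneg_right (le_self_pow₀ hN1 (Nat.succ_ne_zero k))
        hq.nonneg_of_fAlgebra))
  refine ⟨hb, le_of_forall_pos_le_add_smul (y := (1 : R)) fun δ hδ => ?_⟩
  have : orderLimsup x ≤ (1 + δ) • (1 : R) := by
    refine orderLimsup_le_of_locally h0 hb (h.mono ?_)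
    rintro q hq - ⟨N, hN1, hN⟩
    obtain ⟨n, hn⟩ := pow_unbounded_of_one_lt N (lt_add_of_pos_right (1 : ℝ) hδ)
    refine ⟨n, fun k hk => hq.mul_le_smul_of_pow (by linarith) (Nat.succ_ne_zero k)
      ((hN k).trans (smul_le_smul_of_nonneg_right ?_ hq.nonneg_of_fAlgebra))⟩
    exact hn.le.trans (pow_le_pow_right₀ (by linarith) (hk.trans (Nat.le_succ k)))
  rwa [add_smul, one_smul] at this

/-- The increments of `V` dominate those of `x`, so `x n + V n` increases and is bounded; its
supremum minus `v` is the limit of `x`. -/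
theorem exists_order_limit {x V : ℕ → R} {v : R} (hv : IsLUB (Set.range V) v)
    (h : ∀ m n, m ≤ n → |x n - x m| ≤ V n - V m) : ∃ s : R, ∀ m, |x m - s| ≤ v - V m := by
  have hVv : ∀ n, V n ≤ v := fun n => hv.1 ⟨n, rfl⟩
  have hmono : ∀ m n, m ≤ n → x m + V m ≤ x n + V n := fun m n hmn => by
    have h1 := (abs_le'.1 (h m n hmn)).2
    have h2 : x n + V n - (x m + V m) = V n - V m - -(x n - x m) := by abel
    rw [← sub_nonneg, h2]
    exact sub_nonneg.2 h1
  have hup : ∀ m n, x n + V n ≤ x m + v + (v - V m) := fun m n => by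
    refine (hmono n (max m n) (le_max_right _ _)).trans ?_
    have h1 := (abs_le'.1 (h m (max m n) (le_max_left _ _))).1
    set k := max m n
    have h2 : x m + v + (v - V m) - (x k + V k) =
      (V k - V m - (x k - x m)) + ((v - V k) + (v - V k)) := by abel
    rw [← sub_nonneg, h2]
    have h3 := sub_nonneg.2 (hVv k)
    exact add_nonneg (sub_nonneg.2 h1) (add_nonneg h3 h3)
  have hw : IsLUB (Set.range fun n => x n + V n) (⨆ n, (x n + V n)) :=
    isLUB_ciSup ⟨_, by rintro _ ⟨n, rfl⟩; exact hup 0 n⟩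
  set w := ⨆ n, (x n + V n)
  refine ⟨w - v, fun m => abs_le'.2 ⟨?_, ?_⟩⟩
  · have h1 : x m + V m ≤ w := hw.1 ⟨m, rfl⟩
    have h2 : v - V m - (x m - (w - v)) = w - (x m + V m) := by abel
    rw [← sub_nonneg, h2]
    exact sub_nonneg.2 h1
  · have h1 : w ≤ x m + v + (v - V m) := hw.2 (by rintro _ ⟨n, rfl⟩; exact hup m n)
    have h2 : v - V m - -(x m - (w - v)) = x m + v + (v - V m) - w := by abel
    rw [← sub_nonneg, h2]
    exact sub_nonneg.2 h1

namespace Cplx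

/-- Order completeness of the complexification along a bounded increasing control sequence. -/
theorem exists_order_limit {T : ℕ → Cplx R} {V : ℕ → R} {v : R} (hV : Monotone V)
    (hv : IsLUB (Set.range V) v) (h : ∀ m n, m ≤ n → (T n - T m).modulus ≤ V n - V m) :
    ∃ S : Cplx R, ∀ m, (T m - S).modulus ≤ v - V m := by
  obtain ⟨s, hs⟩ := _root_.exists_order_limit (x := fun n => (T n).re) hv fun m n hmn =>
    (abs_re_le_modulus (T n - T m)).trans (h m n hmn)
  obtain ⟨t, ht⟩ := _root_.exists_order_limit (x := fun n => (T n).im) hv fun m n hmn =>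
    (abs_im_le_modulus (T n - T m)).trans (h m n hmn)
  refine ⟨⟨s, t⟩, fun m => ?_⟩
  -- Estimating real and imaginary parts separately loses a factor two. The loss is removed by
  -- passing from `T m` to the limit through a later `T n`, where the doubled error `2 (v - V n)`
  -- has infimum zero.
  have hclose : ∀ n, (T n - ⟨s, t⟩).modulus ≤ (v - V n) + (v - V n) := by
    intro n
    have key : ∀ (c : ℝ) (y : R), |c| ≤ 1 → c • y ≤ |y| := fun c y hc => by
      have h1 := abs_mul_le_mul_abs (c • (1 : R)) y
      have h2 : |c • (1 : R)| ≤ 1 := by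
        obtain ⟨h3, h4⟩ := abs_le.1 hc
        refine abs_le'.2 ⟨?_, ?_⟩
        · simpa using smul_le_smul_of_nonneg_right h4 (zero_le_one : (0 : R) ≤ 1)
        · rw [← neg_smul]
          simpa using smul_le_smul_of_nonneg_right (neg_le.1 h3) (zero_le_one : (0 : R) ≤ 1)
      rw [smul_mul_assoc, one_mul] at h1
      exact (le_abs_self _).trans (h1.trans (mul_le_of_le_one_left (abs_nonneg y) h2))
    exact modulus_le fun θ => add_le_add ((key _ _ (Real.abs_cos_le_one θ)).trans (hs n))
      ((key _ _ (Real.abs_sin_le_one θ)).trans (ht n))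
  set A := (T m - ⟨s, t⟩).modulus
  have h1 : ∀ n, V n ≤ v + v - V m - A := by
    suffices h2 : ∀ n, m ≤ n → V n ≤ v + v - V m - A from fun n =>
      (hV (le_max_right m n)).trans (h2 _ (le_max_left m n))
    intro n hmn
    have h3 : A ≤ (V n - V m) + ((v - V n) + (v - V n)) := by
      have e : T m - ⟨s, t⟩ = -(T n - T m) + (T n - ⟨s, t⟩) := by abel
      calc A = (-(T n - T m) + (T n - ⟨s, t⟩)).modulus := by rw [← e]
        _ ≤ (-(T n - T m)).modulus + (T n - ⟨s, t⟩).modulus := modulus_add_le _ _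
        _ ≤ _ := add_le_add ((modulus_neg _).le.trans (h m n hmn)) (hclose n)
    rw [← sub_nonneg] at h3 ⊢
    refine h3.trans (le_of_eq ?_)
    abel
  have h2 : v ≤ v + v - V m - A := hv.2 (by rintro _ ⟨n, rfl⟩; exact h1 n)
  rw [← sub_nonneg] at h2 ⊢
  refine h2.trans (le_of_eq ?_)
  abel

end Cplx

end Limsup

/-! ### Bounded terms and the root test -/

section PowerSeries

variable {R : Type*} [CommRing R] [Algebra ℝ R] [ConditionallyCompleteLattice R]
  [IsOrderedAddMonoid R] [IsOrderedModule ℝ R] [IsFAlgebra R]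

theorem nthRoot_spec {a : R} (ha : 0 ≤ a) {n : ℕ} (hn : n ≠ 0) :
    0 ≤ nthRoot n a ∧ nthRoot n a ^ n = a := by
  have h := exists_nonneg_pow_eq ha hn
  rw [nthRoot, dif_pos h]
  exact h.choose_spec

theorem rootSeq_nonneg (a : ℕ → Cplx R) (k : ℕ) : 0 ≤ rootSeq a k :=
  (nthRoot_spec (Cplx.modulus_nonneg _) (Nat.succ_ne_zero k)).1

theorem rootSeq_pow (a : ℕ → Cplx R) (k : ℕ) : rootSeq a k ^ (k + 1) = (a (k + 1)).modulus :=
  (nthRoot_spec (Cplx.modulus_nonneg _) (Nat.succ_ne_zero k)).2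

/-- At `z = c + r` the term of index `k + 1` is the difference of the errors of two consecutive
partial sums, each at most `p 0`. -/
theorem exists_bound_of_mem_convergenceSet {a : ℕ → Cplx R} {c : Cplx R} {r : R}
    (hr : r ∈ convergenceSet a c) : ∃ M : R, ∀ k, (r * rootSeq a k) ^ (k + 1) ≤ M := by
  obtain ⟨hr0, S, p, hp, -, h⟩ := hr
  refine ⟨p 0 + p 0, fun k => ?_⟩
  set z : Cplx R := c + ⟨r, 0⟩ with hz
  have hzc : z - c = ⟨r, 0⟩ := by rw [hz]; abel
  have hmem : z ∈ orderBall c r := by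
    change (z - c).modulus ≤ r
    rw [hzc]; exact Cplx.modulus_ofReal_le hr0
  have h1 := h (k + 1) z hmem
  have h2 := h k z hmem
  rw [Finset.sum_range_succ] at h1
  set s := ∑ n ∈ Finset.range (k + 1), a n * (z - c) ^ n
  set w := a (k + 1) * (z - c) ^ (k + 1) with hw
  have e : w = (s + w - S z) - (s - S z) := by abel
  calc (r * rootSeq a k) ^ (k + 1) = (a (k + 1)).modulus * r ^ (k + 1) := by
        rw [mul_pow, rootSeq_pow, mul_comm]
    _ ≤ w.modulus := by
        rw [hw, hzc, Cplx.ofReal_pow]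
        exact Cplx.modulus_mul_ofReal (pow_nonneg hr0 _) _
    _ ≤ (s + w - S z).modulus + (s - S z).modulus := by
        rw [e]; convert Cplx.modulus_sub_le (s + w - S z) (s - S z) using 2; abel_nf
    _ ≤ p 0 + p 0 :=
        add_le_add (h1.trans (hp (Nat.zero_le _))) (h2.trans (hp (Nat.zero_le _)))

theorem orderLimsup_le_one_of_mem_convergenceSet [IsLaterallyComplete R] {a : ℕ → Cplx R}
    {c : Cplx R} {r : R} (hr : r ∈ convergenceSet a c) :
    BddAbove (Set.range fun k => r * rootSeq a k) ∧
      (orderLimsup fun k => r * rootSeq a k) ≤ 1 := by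
  obtain ⟨M, hM⟩ := exists_bound_of_mem_convergenceSet hr
  refine bddAbove_and_orderLimsup_le_one (fun k => mul_nonneg hr.1 (rootSeq_nonneg a k)) ?_
  refine (locally_le_smul M).mono ?_
  rintro q hq - ⟨N, hN1, hN⟩
  exact ⟨N, hN1, fun k => (hq.mul_le_mul (hM k)).trans hN⟩

/-- The root test: a local geometric bound implies uniform convergence in order. -/
theorem mem_convergenceSet_of_locally [IsLaterallyComplete R] {a : ℕ → Cplx R} {c : Cplx R}
    {r : R} (hr : 0 ≤ r) (h : Locally fun q => ∃ s : ℝ, 0 ≤ s ∧ s < 1 ∧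
      ∃ n : ℕ, ∀ k ≥ n, q * (r * rootSeq a k) ≤ s • q) : r ∈ convergenceSet a c := by
  set d : ℕ → R := fun n => (a n).modulus * r ^ n with hd
  have hd0 : ∀ n, 0 ≤ d n := fun n => mul_nonneg (Cplx.modulus_nonneg _) (pow_nonneg hr n)
  set V : ℕ → R := fun m => ∑ n ∈ Finset.range (m + 1), d n with hVdef
  have hV : Monotone V := monotone_nat_of_le_succ fun m => by
    simp only [hVdef]
    rw [Finset.sum_range_succ _ (m + 1)]
    exact le_add_of_nonneg_right (hd0 _)
  have hV0 : ∀ m, 0 ≤ V m := fun m => Finset.sum_nonneg fun n _ => hd0 n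
  have hb : BddAbove (Set.range V) := by
    refine bddAbove_of_locally fun p hp hp0 => ?_
    obtain ⟨q, hq, hq0, hpq, s, hs0, hs1, n, hn⟩ := h p hp hp0
    -- A further refinement bounds the initial segment `V n` by a real `N`; beyond index `n` the
    -- terms are dominated by powers of `s`.
    obtain ⟨q', hq', hq'0, hqq', N, hN1, hN⟩ := locally_le_smul (V n) q hq hq0
    refine ⟨q', hq', hq'0, by rw [← hqq', ← mul_assoc, hpq], N + (1 - s)⁻¹, ?_⟩
    have hsum : ∀ m, q' * V m ≤ (N + ∑ i ∈ Finset.range (m + 1), s ^ i) • q' := by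
      intro m
      rcases le_total m n with hmn | hmn
      · refine (hq'.mul_le_mul (hV hmn)).trans (hN.trans
          (smul_le_smul_of_nonneg_right ?_ hq'.nonneg_of_fAlgebra))
        exact le_add_of_nonneg_right (Finset.sum_nonneg fun i _ => pow_nonneg hs0 i)
      · induction m, hmn using Nat.le_induction with
        | base =>
          refine hN.trans (smul_le_smul_of_nonneg_right ?_ hq'.nonneg_of_fAlgebra)
          exact le_add_of_nonneg_right (Finset.sum_nonneg fun i _ => pow_nonneg hs0 i)
        | succ m hmn ih =>
          have h1 : q' * d (m + 1) ≤ s ^ (m + 1) • q' := by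
            have : d (m + 1) = (r * rootSeq a m) ^ (m + 1) := by
              rw [mul_pow, rootSeq_pow, mul_comm]
            rw [this]
            exact hq'.mul_pow_le_smul (mul_nonneg hr (rootSeq_nonneg a m))
              (mul_le_smul_of_idem_le hq' hq hqq' (hn m hmn))
          calc q' * V (m + 1) = q' * V m + q' * d (m + 1) := by
                simp only [hVdef]; rw [Finset.sum_range_succ _ (m + 1), mul_add]
            _ ≤ (N + ∑ i ∈ Finset.range (m + 1), s ^ i) • q' + s ^ (m + 1) • q' :=
                add_le_add ih h1
            _ = _ := by rw [← add_smul, Finset.sum_range_succ _ (m + 1), add_assoc]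
    rintro _ ⟨m, rfl⟩
    refine (hsum m).trans (smul_le_smul_of_nonneg_right ?_ hq'.nonneg_of_fAlgebra)
    refine add_le_add_right ?_ N
    rw [← tsum_geometric_of_lt_one hs0 hs1]
    exact (summable_geometric_of_lt_one hs0 hs1).sum_le_tsum _ fun i _ => pow_nonneg hs0 i
  have hv : IsLUB (Set.range V) (sSup (Set.range V)) := isLUB_csSup (Set.range_nonempty V) hb
  set v := sSup (Set.range V)
  have hlim : ∀ z ∈ orderBall c r, ∃ S : Cplx R, ∀ m,
      ((∑ n ∈ Finset.range (m + 1), a n * (z - c) ^ n) - S).modulus ≤ v - V m := by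
    intro z hz
    refine Cplx.exists_order_limit (T := fun m => ∑ n ∈ Finset.range (m + 1), a n * (z - c) ^ n)
      hV hv fun m n hmn => ?_
    have hsub : Finset.range (m + 1) ⊆ Finset.range (n + 1) :=
      Finset.range_subset_range.2 (Nat.succ_le_succ hmn)
    simp only [hVdef]
    rw [← Finset.sum_sdiff hsub, add_sub_cancel_right, ← Finset.sum_sdiff hsub,
      add_sub_cancel_right]
    exact (Cplx.modulus_sum_le _ _).trans
      (Finset.sum_le_sum fun i _ => Cplx.modulus_mul_pow_le _ _ hz i)
  choose! S hS using hlim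
  -- The tails of the majorant series control the error for all `z` in the ball at once.
  refine ⟨hr, S, fun m => v - V m, fun m n hmn => sub_le_sub_left (hV hmn) v, ?_,
    fun m z hz => hS z hz m⟩
  refine ⟨?_, fun w hw => ?_⟩
  · rintro _ ⟨m, rfl⟩
    exact sub_nonneg.2 (hv.1 ⟨m, rfl⟩)
  · have : v ≤ v - w := hv.2 (by
      rintro _ ⟨m, rfl⟩
      exact le_sub_comm.1 (hw ⟨m, rfl⟩))
    simpa using this

end PowerSeries

/-! ### The Cauchy–Hadamard formula -/

section CauchyHadamard

variable {R : Type*} [CommRing R] [Algebra ℝ R] [ConditionallyCompleteLattice R]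
  [IsOrderedAddMonoid R] [IsOrderedModule ℝ R] [IsFAlgebra R] [IsLaterallyComplete R]

theorem orderBounded_iff_bddAbove {s : Set R} (h : ∀ x ∈ s, 0 ≤ x) :
    OrderBounded s ↔ BddAbove s :=
  ⟨fun ⟨_, v, hv⟩ => ⟨v, fun _ hx => (hv hx).2⟩, fun ⟨v, hv⟩ => ⟨0, v, fun x hx => ⟨h x hx, hv hx⟩⟩⟩

theorem zero_mem_convergenceSet (a : ℕ → Cplx R) (c : Cplx R) : (0 : R) ∈ convergenceSet a c :=
  mem_convergenceSet_of_locally le_rfl fun p hp hp0 =>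
    ⟨p, hp, hp0, hp.eq, 0, le_rfl, one_pos, 0, fun k _ => by simp⟩

theorem orderBounded_range_rootSeq_iff (a : ℕ → Cplx R) :
    OrderBounded (Set.range (rootSeq a)) ↔ BddAbove (Set.range (rootSeq a)) :=
  orderBounded_iff_bddAbove (by rintro _ ⟨k, rfl⟩; exact rootSeq_nonneg a k)

theorem orderBounded_convergenceSet_iff (a : ℕ → Cplx R) (c : Cplx R) :
    OrderBounded (convergenceSet a c) ↔ BddAbove (convergenceSet a c) :=
  orderBounded_iff_bddAbove fun _ hx => hx.1

/-- Stated for a bounded minorant `x` of the roots: part (ii) needs the projected roots, since the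
roots themselves may be unbounded off the band of `ρ_S`. -/
theorem mul_orderLimsup_le_one {a : ℕ → Cplx R} {c : Cplx R} {r : R}
    (hr : r ∈ convergenceSet a c) {x : ℕ → R} (h0 : ∀ k, 0 ≤ x k)
    (hb : BddAbove (Set.range x)) (hx : ∀ k, x k ≤ rootSeq a k) : r * orderLimsup x ≤ 1 := by
  obtain ⟨M, hM⟩ := exists_bound_of_mem_convergenceSet hr
  rw [← orderLimsup_mul_left h0 hb hr.1]
  refine (bddAbove_and_orderLimsup_le_one (fun k => mul_nonneg hr.1 (h0 k)) ?_).2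
  refine (locally_le_smul M).mono ?_
  rintro q hq - ⟨N, hN1, hN⟩
  refine ⟨N, hN1, fun k => (hq.mul_le_mul ((pow_le_pow_left₀ (mul_nonneg hr.1 (h0 k))
    (mul_le_mul_of_nonneg_left (hx k) hr.1) _).trans (hM k))).trans hN⟩

/-- Only `r * rootSeq a k` enters the root test, so the roots may be replaced by any bounded
sequence that agrees with them after multiplication by `r`. -/
theorem mem_convergenceSet_of_mul_orderLimsup_le {a : ℕ → Cplx R} {c : Cplx R} {r : R}
    (hr : 0 ≤ r) {x : ℕ → R} (h0 : ∀ k, 0 ≤ x k) (hb : BddAbove (Set.range x))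
    (hx : ∀ k, r * rootSeq a k = r * x k) {t : ℝ} (ht : t < 1) (h : r * orderLimsup x ≤ t • 1) :
    r ∈ convergenceSet a c := by
  obtain ⟨s, hs, hs1⟩ := exists_between (max_lt ht one_pos)
  rw [← orderLimsup_mul_left h0 hb hr] at h
  have hb' : BddAbove (Set.range fun k => r * x k) := by
    obtain ⟨B, hB⟩ := hb
    refine ⟨r * B, ?_⟩
    rintro _ ⟨k, rfl⟩
    exact mul_le_mul_of_nonneg_left (hB ⟨k, rfl⟩) hr
  refine mem_convergenceSet_of_locally hr ((locally_le_of_orderLimsup_le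
    (fun k => mul_nonneg hr (h0 k)) hb' ((le_max_left t 0).trans_lt hs) h).mono ?_)
  rintro q hq - ⟨n, hn⟩
  exact ⟨s, (le_max_right t 0).trans hs.le, hs1, n, fun k hk => by rw [hx]; exact hn k hk⟩

/-- The inverse of the order limit superior of the roots is the projected radius. -/
theorem isLUB_bandProj_convergenceSet {a : ℕ → Cplx R} {c : Cplx R}
    (hb : BddAbove (Set.range (rootSeq a))) :
    ∃ y : R, 0 ≤ y ∧ IsBandInverse (orderLimsup (rootSeq a)) y ∧
      IsLUB (bandProj (orderLimsup (rootSeq a)) '' convergenceSet a c) y := by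
  set L := orderLimsup (rootSeq a)
  have hL0 : 0 ≤ L := orderLimsup_nonneg (rootSeq_nonneg a) hb
  obtain ⟨y, hy0, hy⟩ := exists_isBandInverse hL0
  have hei := isIdempotentElem_bandProj_one L
  refine ⟨y, hy0, hy, ?_, fun w hw => ?_⟩
  · rintro _ ⟨r, hr, rfl⟩
    have h1 := mul_orderLimsup_le_one hr (rootSeq_nonneg a) hb fun _ => le_rfl
    rw [bandProj_eq_mul, ← hy.2.2, mul_assoc, mul_comm _ r]
    exact (mul_le_mul_of_nonneg_left h1 hy0).trans (mul_one y).le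
  · refine le_of_forall_pos_le_add_smul (y := y) fun ε hε => ?_
    -- The element `t • y` has `t • y * L ≤ t < 1`, so it lies in the convergence set and is at most
    -- `w`; the remainder `(1 - t) • y` is at most `ε • y`.
    set t : ℝ := max (1 - ε) 0 with ht
    have ht0 : 0 ≤ t := le_max_right _ _
    have ht1 : t < 1 := max_lt (by linarith) one_pos
    have hmem : t • y ∈ convergenceSet a c := by
      refine mem_convergenceSet_of_mul_orderLimsup_le (smul_nonneg ht0 hy0) (rootSeq_nonneg a) hb
        (fun _ => rfl) ht1 ?_
      rw [smul_mul_assoc, hy.2.2]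
      exact smul_le_smul_of_nonneg_left hei.le_one_of_fAlgebra ht0
    have h1 : t • y ≤ w := by
      refine le_trans (le_of_eq ?_) (hw ⟨_, hmem, rfl⟩)
      rw [bandProj_eq_mul, mul_smul_comm, mem_principalBand_iff.1 hy.1]
    calc y = t • y + (1 - t) • y := by module
      _ ≤ w + ε • y := add_le_add h1 (smul_le_smul_of_nonneg_right
          (by linarith [le_max_left (1 - ε) 0]) hy0)

theorem isLUB_radius {a : ℕ → Cplx R} {c : Cplx R} (hΩ : BddAbove (convergenceSet a c)) :
    IsLUB (convergenceSet a c) (radius a c) :=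
  isLUB_csSup ⟨0, zero_mem_convergenceSet a c⟩ hΩ

theorem radius_nonneg {a : ℕ → Cplx R} {c : Cplx R} (hΩ : BddAbove (convergenceSet a c)) :
    0 ≤ radius a c := (isLUB_radius hΩ).1 (zero_mem_convergenceSet a c)

/-- Wherever `ρ_S` does not vanish, some `r` in the convergence set is at least some `ε > 0` on a
smaller idempotent. There the bound on `r * rootSeq a k` can be divided by `ε`; off the band the
projections are zero. -/
theorem bddAbove_bandProj_rootSeq {a : ℕ → Cplx R} {c : Cplx R}
    (hΩ : BddAbove (convergenceSet a c)) :
    BddAbove (Set.range fun k => bandProj (radius a c) (rootSeq a k)) := by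
  have hlub := isLUB_radius hΩ
  have hρ0 := radius_nonneg hΩ
  set ρ := radius a c
  have hei := isIdempotentElem_bandProj_one ρ
  simp only [bandProj_eq_mul ρ (rootSeq a _)]
  refine bddAbove_of_locally fun p hp hp0 => ?_
  by_cases hpe : p * bandProj ρ 1 = 0
  · refine ⟨p, hp, hp0, hp.eq, 0, ?_⟩
    rintro _ ⟨k, rfl⟩
    simp only
    rw [← mul_assoc, hpe, zero_mul, zero_smul]
  obtain ⟨r, hr, hpr⟩ : ∃ r ∈ convergenceSet a c, ¬ p * r ≤ p * 0 := by
    by_contra! hc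
    refine hpe (hp.mul_bandProj_one_eq_zero (le_antisymm ?_ (mul_nonneg hp.nonneg_of_fAlgebra hρ0)))
    refine (hlub.mul_left_of_fAlgebra hp.nonneg_of_fAlgebra).2 ?_
    rintro _ ⟨r, hr, rfl⟩
    simpa using hc r hr
  obtain ⟨q, hq, hq0, hpq, ε, hε, hgap⟩ := (hp.le_or_gap r 0).resolve_left hpr
  obtain ⟨B, hB⟩ := (orderLimsup_le_one_of_mem_convergenceSet hr).1
  obtain ⟨q', hq', hq'0, hqq', N, -, hN⟩ := locally_le_smul B q hq hq0
  refine ⟨q', hq', hq'0, by rw [← hqq', ← mul_assoc, hpq], ε⁻¹ * N, ?_⟩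
  rintro _ ⟨k, rfl⟩
  have hb0 := rootSeq_nonneg a k
  have h1 : ε • q' ≤ q' * r := smul_le_mul_of_idem_le hq' hq hqq' (by simpa using hgap)
  have h2 : ε • (q' * rootSeq a k) ≤ N • q' := by
    rw [← smul_mul_assoc]
    refine (mul_le_mul_of_nonneg_right h1 hb0).trans ?_
    rw [mul_assoc]
    exact (hq'.mul_le_mul (hB ⟨k, rfl⟩)).trans hN
  have h3 := smul_le_smul_of_nonneg_left h2 (inv_pos.2 hε).le
  rw [inv_smul_smul₀ hε.ne', smul_smul] at h3
  exact (hq'.mul_le_mul (hei.mul_le_self hb0)).trans h3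

/-- The projected order limit superior of the roots is the inverse of the radius. -/
theorem isBandInverse_radius {a : ℕ → Cplx R} {c : Cplx R}
    (hΩ : BddAbove (convergenceSet a c)) :
    IsBandInverse (radius a c)
      (orderLimsup fun k => bandProj (radius a c) (rootSeq a k)) := by
  have hlub := isLUB_radius hΩ
  have hρ0 := radius_nonneg hΩ
  have hb := bddAbove_bandProj_rootSeq hΩ
  set ρ := radius a c
  have hei := isIdempotentElem_bandProj_one ρ
  have heρ := bandProj_one_mul_self ρ
  simp only [bandProj_eq_mul ρ (rootSeq a _)] at hb ⊢
  set e := bandProj ρ 1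
  have h0 : ∀ k, 0 ≤ e * rootSeq a k := fun k =>
    mul_nonneg hei.nonneg_of_fAlgebra (rootSeq_nonneg a k)
  have heΛ := orderLimsup_mul_left h0 hb hei.nonneg_of_fAlgebra
  simp only [← mul_assoc, hei.eq] at heΛ
  have hΛ0 := orderLimsup_nonneg h0 hb
  set Λ := orderLimsup fun k => e * rootSeq a k with hΛ
  have hle : ρ * Λ ≤ e := by
    have h1 : Λ * ρ ≤ 1 := by
      refine (hlub.mul_left_of_fAlgebra hΛ0).2 ?_
      rintro _ ⟨r, hr, rfl⟩
      simp only
      rw [mul_comm]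
      exact mul_orderLimsup_le_one hr h0 hb fun k => hei.mul_le_self (rootSeq_nonneg a k)
    calc ρ * Λ = e * (Λ * ρ) := by rw [mul_left_comm, heρ, mul_comm]
      _ ≤ e * 1 := hei.mul_le_mul h1
      _ = e := mul_one e
  have hge : e ≤ ρ * Λ := by
    by_contra hc
    obtain ⟨p, hp, hp0, δ, hδ, hgap⟩ := exists_idem_gap hc
    have hpi : IsIdempotentElem (p * e) := hp.mul_of_fAlgebra hei
    have hpe0 : p * e ≠ 0 := fun h => by
      rw [h] at hgap
      refine not_smul_idem_nonpos hp hp0 hδ (le_trans (le_add_of_nonneg_left ?_) hgap)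
      exact mul_nonneg hp.nonneg_of_fAlgebra (mul_nonneg hρ0 hΛ0)
    have hpee : p * e * e = p * e := by rw [mul_assoc, hei.eq]
    have hgap' : p * e * (ρ * Λ) ≤ (1 - δ) • (p * e) := by
      have h1 := hei.mul_le_mul hgap
      have h2 : e * (p * (ρ * Λ) + δ • p) = p * e * (ρ * Λ) + δ • (p * e) := by
        simp only [Algebra.smul_def]; ring
      rw [h2, mul_left_comm e p e, hei.eq, ← le_sub_iff_add_le] at h1
      rwa [sub_smul, one_smul]
    have hr0 : 0 ≤ (1 + δ) • (p * e * ρ) :=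
      smul_nonneg (by linarith) (mul_nonneg hpi.nonneg_of_fAlgebra hρ0)
    -- On `p * e` the product `ρ * Λ` is at most `1 - δ`, and `(1 + δ) * (1 - δ) < 1`, so the radius
    -- enlarged by `1 + δ` there is still admissible. The maximum with `0` covers `δ > 1`.
    have hmem : (1 + δ) • (p * e * ρ) ∈ convergenceSet a c := by
      refine mem_convergenceSet_of_mul_orderLimsup_le hr0 h0 hb (fun k => ?_)
        (t := max ((1 + δ) * (1 - δ)) 0) (max_lt (by nlinarith) one_pos) ?_
      · rw [smul_mul_assoc, smul_mul_assoc, mul_assoc (p * e), mul_assoc (p * e), ← mul_assoc ρ,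
          mul_comm ρ e, heρ]
      · calc (1 + δ) • (p * e * ρ) * Λ = (1 + δ) • (p * e * (ρ * Λ)) := by
              rw [smul_mul_assoc, mul_assoc (p * e)]
          _ ≤ (1 + δ) • (1 - δ) • (p * e) :=
              smul_le_smul_of_nonneg_left hgap' (by linarith)
          _ = ((1 + δ) * (1 - δ)) • (p * e) := smul_smul _ _ _
          _ ≤ (max ((1 + δ) * (1 - δ)) 0) • (p * e) :=
              smul_le_smul_of_nonneg_right (le_max_left _ _) hpi.nonneg_of_fAlgebra
          _ ≤ _ := smul_le_smul_of_nonneg_left hpi.le_one_of_fAlgebra (le_max_right _ _)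
    have h1 := hpi.mul_le_mul (hlub.1 hmem)
    rw [mul_smul_comm, ← mul_assoc, hpi.eq, add_smul, one_smul] at h1
    have h2 : δ • (p * e * ρ) ≤ 0 := by simpa using h1
    have h3 : p * e * ρ = 0 := by
      refine le_antisymm ?_ (mul_nonneg hpi.nonneg_of_fAlgebra hρ0)
      have := smul_le_smul_of_nonneg_left h2 (inv_pos.2 hδ).le
      rwa [inv_smul_smul₀ hδ.ne', smul_zero] at this
    exact hpe0 (hpee ▸ hpi.mul_bandProj_one_eq_zero h3)
  have hinv : ρ * Λ = e := le_antisymm hle hge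
  exact ⟨mem_principalBand_iff.2 heΛ.symm, hinv, (mul_comm _ _).trans hinv⟩

theorem bddAbove_convergenceSet_of_isWeakOrderUnit {a : ℕ → Cplx R} {c : Cplx R}
    (hb : BddAbove (Set.range (rootSeq a))) (hL : IsWeakOrderUnit (orderLimsup (rootSeq a))) :
    BddAbove (convergenceSet a c) ∧ orderLimsup (rootSeq a) * radius a c = 1 := by
  obtain ⟨y, -, hy, hlub⟩ := isLUB_bandProj_convergenceSet (c := c) hb
  have h1 := (isWeakOrderUnit_iff hL.1).1 hL
  have h2 : bandProj (orderLimsup (rootSeq a)) '' convergenceSet a c = convergenceSet a c := by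
    have : ∀ x, bandProj (orderLimsup (rootSeq a)) x = x := fun x => by
      rw [bandProj_eq_mul, h1, one_mul]
    simp [this]
  rw [h2] at hlub
  refine ⟨⟨y, hlub.1⟩, ?_⟩
  rw [(isLUB_radius ⟨y, hlub.1⟩).unique hlub, hy.2.1, h1]

theorem bddAbove_rootSeq_of_isWeakOrderUnit {a : ℕ → Cplx R} {c : Cplx R}
    (hΩ : BddAbove (convergenceSet a c)) (hρ : IsWeakOrderUnit (radius a c)) :
    BddAbove (Set.range (rootSeq a)) ∧ orderLimsup (rootSeq a) * radius a c = 1 := by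
  have h1 := (isWeakOrderUnit_iff hρ.1).1 hρ
  have h2 : (fun k => bandProj (radius a c) (rootSeq a k)) = rootSeq a :=
    funext fun k => by rw [bandProj_eq_mul, h1, one_mul]
  have hb := bddAbove_bandProj_rootSeq hΩ
  have hinv := (isBandInverse_radius hΩ).2.2
  rw [h2] at hb hinv
  exact ⟨hb, hinv.trans h1⟩

theorem convergenceSet_eq_nonneg_of_orderLimsup_eq_zero {a : ℕ → Cplx R} {c : Cplx R}
    (hb : BddAbove (Set.range (rootSeq a))) (hL : orderLimsup (rootSeq a) = 0) :
    convergenceSet a c = {r : R | 0 ≤ r} := by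
  refine Set.Subset.antisymm (fun r hr => hr.1) fun r hr => ?_
  refine mem_convergenceSet_of_mul_orderLimsup_le hr (rootSeq_nonneg a) hb (fun _ => rfl)
    one_pos ?_
  rw [hL, mul_zero, zero_smul]

/-- Membership of `1` bounds the roots, and membership of every natural number `n` gives `n * L ≤
1`, so `L = 0` by the Archimedean property. -/
theorem orderLimsup_eq_zero_of_convergenceSet_eq {a : ℕ → Cplx R} {c : Cplx R}
    (h : convergenceSet a c = {r : R | 0 ≤ r}) :
    BddAbove (Set.range (rootSeq a)) ∧ orderLimsup (rootSeq a) = 0 := by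
  have hmem : ∀ r : R, 0 ≤ r → r ∈ convergenceSet a c := fun r hr => by rw [h]; exact hr
  have hb : BddAbove (Set.range (rootSeq a)) := by
    simpa using (orderLimsup_le_one_of_mem_convergenceSet (hmem 1 zero_le_one)).1
  refine ⟨hb, le_antisymm ?_ (orderLimsup_nonneg (rootSeq_nonneg a) hb)⟩
  refine nonpos_of_forall_nsmul_le (y := 1) fun n => ?_
  rw [nsmul_eq_mul]
  exact mul_orderLimsup_le_one (hmem n (Nat.cast_nonneg n)) (rootSeq_nonneg a) hb fun _ => le_rfl

theorem cauchyHadamard (a : ℕ → Cplx R) (c : Cplx R) :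
    (OrderBounded (Set.range (rootSeq a)) →
      OrderBounded (bandProj (orderLimsup (rootSeq a)) '' convergenceSet a c) ∧
      ∃ Lstar : R, IsBandInverse (orderLimsup (rootSeq a)) Lstar ∧
        IsLUB (bandProj (orderLimsup (rootSeq a)) '' convergenceSet a c) Lstar) ∧
    (OrderBounded (convergenceSet a c) →
      OrderBounded (Set.range fun k => bandProj (radius a c) (rootSeq a k)) ∧
      IsBandInverse (radius a c)
        (orderLimsup fun k => bandProj (radius a c) (rootSeq a k))) ∧
    ((OrderBounded (Set.range (rootSeq a)) ∧ IsWeakOrderUnit (orderLimsup (rootSeq a))) ↔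
      (OrderBounded (convergenceSet a c) ∧ IsWeakOrderUnit (radius a c))) ∧
    (OrderBounded (Set.range (rootSeq a)) ∧ IsWeakOrderUnit (orderLimsup (rootSeq a)) →
      orderLimsup (rootSeq a) * radius a c = 1 ∧ radius a c * orderLimsup (rootSeq a) = 1) ∧
    ((OrderBounded (Set.range (rootSeq a)) ∧ orderLimsup (rootSeq a) = 0) ↔
      convergenceSet a c = {r : R | 0 ≤ r}) := by
  have hproj : ∀ u x : R, 0 ≤ x → 0 ≤ bandProj u x := fun u x hx => by
    rw [bandProj_eq_mul]
    exact mul_nonneg (isIdempotentElem_bandProj_one u).nonneg_of_fAlgebra hx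
  rw [orderBounded_range_rootSeq_iff, orderBounded_convergenceSet_iff,
    orderBounded_iff_bddAbove (by rintro _ ⟨r, hr, rfl⟩; exact hproj _ _ hr.1),
    orderBounded_iff_bddAbove (by rintro _ ⟨k, rfl⟩; exact hproj _ _ (rootSeq_nonneg a k))]
  refine ⟨fun hb => ?_, fun hΩ => ⟨bddAbove_bandProj_rootSeq hΩ, isBandInverse_radius hΩ⟩,
    ⟨fun ⟨hb, hL⟩ => ?_, fun ⟨hΩ, hρ⟩ => ?_⟩, fun ⟨hb, hL⟩ => ?_,
    fun ⟨hb, hL⟩ => convergenceSet_eq_nonneg_of_orderLimsup_eq_zero hb hL,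
    orderLimsup_eq_zero_of_convergenceSet_eq⟩
  · obtain ⟨y, -, hy, hlub⟩ := isLUB_bandProj_convergenceSet (c := c) hb
    exact ⟨⟨y, hlub.1⟩, y, hy, hlub⟩
  · obtain ⟨hΩ, h1⟩ := bddAbove_convergenceSet_of_isWeakOrderUnit (c := c) hb hL
    exact ⟨hΩ, isWeakOrderUnit_of_mul_eq_one (radius_nonneg hΩ) ((mul_comm _ _).trans h1)⟩
  · obtain ⟨hb, h1⟩ := bddAbove_rootSeq_of_isWeakOrderUnit hΩ hρ
    exact ⟨hb, isWeakOrderUnit_of_mul_eq_one (orderLimsup_nonneg (rootSeq_nonneg a) hb) h1⟩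
  · have h1 := (bddAbove_convergenceSet_of_isWeakOrderUnit (c := c) hb hL).2
    exact ⟨h1, (mul_comm _ _).trans h1⟩

end CauchyHadamard

/-- Cauchy-Hadamard formula for a power series `S(z) = ∑ a_n (z - c)^n` on the universally
complete complex vector lattice `R ⊕ iR`. The real part `R` is a Dedekind complete (hence
Archimedean) and laterally complete vector lattice with a `Φ`-algebra multiplication. -/
theorem theorem3p11 {R : Type*} [Ring R] [Algebra ℝ R] [ConditionallyCompleteLattice R]
    [IsOrderedAddMonoid R] [IsOrderedModule ℝ R] [IsFAlgebra R] [IsLaterallyComplete R]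
    (a : ℕ → Cplx R) (c : Cplx R) :
    (OrderBounded (Set.range (rootSeq a)) →
      OrderBounded (bandProj (orderLimsup (rootSeq a)) '' convergenceSet a c) ∧
      ∃ Lstar : R, IsBandInverse (orderLimsup (rootSeq a)) Lstar ∧
        IsLUB (bandProj (orderLimsup (rootSeq a)) '' convergenceSet a c) Lstar) ∧
    (OrderBounded (convergenceSet a c) →
      OrderBounded (Set.range fun k => bandProj (radius a c) (rootSeq a k)) ∧
      IsBandInverse (radius a c)
        (orderLimsup fun k => bandProj (radius a c) (rootSeq a k))) ∧
    ((OrderBounded (Set.range (rootSeq a)) ∧ IsWeakOrderUnit (orderLimsup (rootSeq a))) ↔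
      (OrderBounded (convergenceSet a c) ∧ IsWeakOrderUnit (radius a c))) ∧
    (OrderBounded (Set.range (rootSeq a)) ∧ IsWeakOrderUnit (orderLimsup (rootSeq a)) →
      orderLimsup (rootSeq a) * radius a c = 1 ∧ radius a c * orderLimsup (rootSeq a) = 1) ∧
    ((OrderBounded (Set.range (rootSeq a)) ∧ orderLimsup (rootSeq a) = 0) ↔
      convergenceSet a c = {r : R | 0 ≤ r}) := by
  -- Commutativity is automatic, so the ring structure is upgraded without changing its operations
  -- and the commutative version applies.
  let _ : CommRing R := { ‹Ring R› with mul_comm := mul_comm_of_fAlgebra }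
  exact cauchyHadamard a c
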